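/- Let $\mathcal U,\mathcal Y$ be separable complex Hilbert spaces, let $\mathbb C^+=\{\mu\in\mathbb C:\operatorname{Re}\mu>0\}$ and $\mathbb D=\{z\in\mathbb C:|z|<1\}$, and let $\varphi$ be a holomorphic function on $\mathbb C^+$ whose values are contractions $\mathcal U\to\mathcal Y$. Let $\mathcal H_o$ be the Hilbert space of $\mathcal Y$-valued functions on $\mathbb C^+$ with reproducing kernel $$K_o(\mu,\lambda)=\frac{1-\varphi(\mu)\varphi(\lambda)^*}{\mu+\overline\lambda}.$$ The canonical observable co-energy-preserving model of $\varphi$ is the operator $S_o=\left[\begin{smallmatrix}A\&B\\ C\&D\end{smallmatrix}\right]_o:\mathcal H_o\times\mathcal U\supset\operatorname{dom}S_o\to\mathcal H_o\times\mathcal Y$ whose domain consists of all $(x,u)$ for which there is $y\in\mathcal Y$ such that $z(\mu)=\mu x(\mu)+\varphi(\mu)u-y$ defines an element $z\in\mathcal H_o$; then $y$ is unique and $S_o(x,u)=(z,y)$. For a system node $S=\left[\begin{smallmatrix}A\&B\\ C\&D\end{smallmatrix}\right]$ on $(\mathcal U,\mathcal X,\mathcal Y)$ (a closed operator from $\mathcal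 X\times\mathcal U$ to $\mathcal X\times\mathcal Y$ such that $Ax=[A\&B](x,0)$ generates a $C_0$-semigroup on $\mathcal X$, such that $A\&B$ extends to a continuous operator $[A|_{\mathcal X}\ B]:\mathcal X\times\mathcal U\to\mathcal X_{-1}$, where $\mathcal X_{-1}$ is the completion of $\mathcal X$ in the norm $\|(\beta-A)^{-1}x\|$ for some $\beta$ in the resolvent set of $A$, and such that $\operatorname{dom}S=\{(x,u):A|_{\mathcal X}x+Bu\in\mathcal X\}$), put $Cx=[C\&D](x,0)$ for $x\in\operatorname{dom}A$. The internal Cayley transform of $S$ with parameter $\alpha$ in the resolvent set of $A$, where $\operatorname{Re}\alpha>0$, consists of the bounded operators $$\mathbf A=(\overline\alpha+A)(\alpha-A)^{-1},\quad \mathbf B=\sqrt{2\operatorname{Re}\alpha}\,(\alpha-A|_{\mathcal X})^{-1}B,\quad \mathbf C=\sqrt{2\operatorname{Re}\alpha}\,C(\alpha-A)^{-1},\quad \mathbf Du=[C\&D]\big((\alpha-A|_{\mathcal X})^{-1}Bu,\,u\big).$$ Fix $\alpha\in\mathbb C^+$, let $z_\alpha(\mu)=\frac{\alpha-\mu}{\overline\alpha+\mu}$,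 which maps $\mathbb C^+$ bijectively onto $\mathbb D$ with inverse $\mu_\alpha(z)=\frac{\alpha-\overline\alpha z}{1+z}$, and let $\phi_\alpha=\varphi\circ\mu_\alpha$. Let $\mathrm H_{o,\alpha}$ be the Hilbert space of $\mathcal Y$-valued functions on $\mathbb D$ with reproducing kernel $\frac{1-\phi_\alpha(z)\phi_\alpha(w)^*}{1-z\overline w}$. Quotients below are extended by continuity at their removable singularities. Then the following hold. 1. $S_o$ is a system node, $\alpha$ belongs to the resolvent set of its main operator, and its internal Cayley transform with parameter $\alpha$ is given, for $x\in\mathcal H_o$, $u\in\mathcal U$, $\mu\in\mathbb C^+$, by $$(\mathbf A_ox)(\mu)=\frac{\overline\alpha+\mu}{\alpha-\mu}\,x(\mu)-\frac{2\operatorname{Re}\alpha}{\alpha-\mu}\,x(\alpha),\qquad (\mathbf B_ou)(\mu)=\sqrt{2\operatorname{Re}\alpha}\,\frac{\varphi(\mu)-\varphi(\alpha)}{\alpha-\mu}\,u,$$ $$\mathbf C_ox=\sqrt{2\operatorname{Re}\alpha}\,x(\alpha),\qquad \mathbf D_ou=\varphi(\alpha)u.$$ 2. The formula $$(\Xi_\alpha\xi)(\mu)=\frac{\sqrt{2\operatorname{Re}\alpha}}{\overline\alpha+\mu}\,\xi\big(z_\alpha(\mu)\big),\qquad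 \xi\in\mathrm H_{o,\alpha},\ \mu\in\mathbb C^+,$$ defines a unitary operator $\Xi_\alpha$ from $\mathrm H_{o,\alpha}$ onto $\mathcal H_o$, and its inverse is $$(\Xi_\alpha^{-1}\zeta)(z)=\frac{\sqrt{2\operatorname{Re}\alpha}}{1+z}\,\zeta\big(\mu_\alpha(z)\big),\qquad \zeta\in\mathcal H_o,\ z\in\mathbb D.$$ 3. The formulas $(\mathrm A_of)(z)=\frac{f(z)-f(0)}{z}$, $(\mathrm B_ou)(z)=\frac{\phi_\alpha(z)-\phi_\alpha(0)}{z}u$, $\mathrm C_of=f(0)$, $\mathrm D_ou=\phi_\alpha(0)u$ define bounded operators $\mathrm A_o:\mathrm H_{o,\alpha}\to\mathrm H_{o,\alpha}$, $\mathrm B_o:\mathcal U\to\mathrm H_{o,\alpha}$, $\mathrm C_o:\mathrm H_{o,\alpha}\to\mathcal Y$, $\mathrm D_o:\mathcal U\to\mathcal Y$ (the classical disk model of $\phi_\alpha$), and $$\mathbf A_o\Xi_\alpha=\Xi_\alpha\mathrm A_o,\qquad \mathbf B_o=\Xi_\alpha\mathrm B_o,\qquad \mathbf C_o\Xi_\alpha=\mathrm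 C_o,\qquad \mathbf D_o=\mathrm D_o.$$ -/

import Mathlib

open scoped InnerProductSpace ComplexConjugate

namespace DBR

/-! ### Half-plane, disk, Schur class and the linear fractional change of variable -/

/-- The open right half-plane. -/
def rightHalfPlane : Set ℂ := {μ | 0 < μ.re}

/-- The open unit disk. -/
def unitDisk : Set ℂ := Metric.ball 0 1

/-- The Schur class over `Ω`: holomorphic functions on `Ω` whose values are contractions from
`U` to `Y`. (A total function on `ℂ`, of which only the restriction to `Ω` is ever used.) -/
structure Schur (Ω : Set ℂ) (U Y : Type*) [NormedAddCommGroup U] [InnerProductSpace ℂ U]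
    [NormedAddCommGroup Y] [InnerProductSpace ℂ Y] where
  toFun : ℂ → U →L[ℂ] Y
  differentiableOn : DifferentiableOn ℂ toFun Ω
  norm_le_one : ∀ z ∈ Ω, ‖toFun z‖ ≤ 1

section change_of_variable

theorem conj_add_ne_zero (α μ : rightHalfPlane) : conj (α : ℂ) + (μ : ℂ) ≠ 0 := by
  intro h
  have h1 := congrArg Complex.re h
  have h2 : 0 < (α : ℂ).re := α.2
  have h3 : 0 < (μ : ℂ).re := μ.2
  simp only [Complex.add_re, Complex.conj_re, Complex.zero_re] at h1
  linarith

theorem one_add_ne_zero {z : ℂ} (hz : z ∈ unitDisk) : 1 + z ≠ 0 := by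
  intro h
  have h1 : z = -1 := by linear_combination h
  simp [unitDisk, h1] at hz

theorem toDisk_mem (α μ : rightHalfPlane) :
    ((α : ℂ) - μ) / (conj (α : ℂ) + μ) ∈ unitDisk := by
  have h2 : 0 < (α : ℂ).re := α.2
  have h3 : 0 < (μ : ℂ).re := μ.2
  have h0 := conj_add_ne_zero α μ
  simp only [unitDisk, Metric.mem_ball, dist_zero_right, norm_div]
  rw [div_lt_one (norm_pos_iff.mpr h0)]
  rw [← sq_lt_sq₀ (norm_nonneg _) (norm_nonneg _), ← Complex.normSq_eq_norm_sq,
    ← Complex.normSq_eq_norm_sq, Complex.normSq_apply, Complex.normSq_apply]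
  simp only [Complex.sub_re, Complex.sub_im, Complex.add_re, Complex.add_im, Complex.conj_re,
    Complex.conj_im]
  nlinarith [mul_pos h2 h3]

theorem toHalfPlane_mem (α : rightHalfPlane) {z : ℂ} (hz : z ∈ unitDisk) :
    ((α : ℂ) - conj (α : ℂ) * z) / (1 + z) ∈ rightHalfPlane := by
  have h2 : 0 < (α : ℂ).re := α.2
  have h0 := one_add_ne_zero hz
  have hz1 : ‖z‖ < 1 := by simpa [unitDisk] using hz
  have hz2 : z.re * z.re + z.im * z.im < 1 := by
    rw [← Complex.normSq_apply, Complex.normSq_eq_norm_sq]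
    nlinarith [norm_nonneg z]
  have hn : 0 < Complex.normSq (1 + z) := Complex.normSq_pos.mpr h0
  simp only [rightHalfPlane, Set.mem_ofPred_eq, Complex.div_re]
  rw [← add_div]
  apply div_pos _ hn
  simp only [Complex.sub_re, Complex.sub_im, Complex.add_re, Complex.add_im, Complex.mul_re,
    Complex.mul_im, Complex.conj_re, Complex.conj_im, Complex.one_re, Complex.one_im]
  nlinarith

/-- The map `z_α(μ) = (α - μ) / (ᾱ + μ)` from the right half-plane to the unit disk. -/
noncomputable def toDisk (α μ : rightHalfPlane) : unitDisk :=
  ⟨((α : ℂ) - μ) / (conj (α : ℂ) + μ), toDisk_mem α μ⟩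

/-- The inverse map `μ_α(z) = (α - ᾱ z) / (1 + z)` from the unit disk to the right half-plane. -/
noncomputable def toHalfPlane (α : rightHalfPlane) (z : unitDisk) : rightHalfPlane :=
  ⟨((α : ℂ) - conj (α : ℂ) * z) / (1 + z), toHalfPlane_mem α z.2⟩

theorem toHalfPlane_toDisk (α μ : rightHalfPlane) : toHalfPlane α (toDisk α μ) = μ := by
  apply Subtype.ext
  have h0 := conj_add_ne_zero α μ
  have h1 := conj_add_ne_zero α α
  have h2 : 1 + ((α : ℂ) - μ) / (conj (α : ℂ) + μ) ≠ 0 := one_add_ne_zero (toDisk_mem α μ)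
  simp only [toHalfPlane, toDisk]
  rw [div_eq_iff h2]
  field_simp
  ring

end change_of_variable

/-- The Schur function `φ_α = φ ∘ μ_α` on the disk obtained from a Schur function `φ` on the
right half-plane. -/
noncomputable def Schur.onDisk {U Y : Type*} [NormedAddCommGroup U] [InnerProductSpace ℂ U]
    [NormedAddCommGroup Y] [InnerProductSpace ℂ Y] (φ : Schur rightHalfPlane U Y)
    (α : rightHalfPlane) : Schur unitDisk U Y where
  toFun z := φ.toFun (((α : ℂ) - conj (α : ℂ) * z) / (1 + z))
  differentiableOn := by
    refine φ.differentiableOn.comp (t := rightHalfPlane) ?_ fun z hz => toHalfPlane_mem α hz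
    refine DifferentiableOn.div (by fun_prop) (by fun_prop) fun z hz => one_add_ne_zero hz
  norm_le_one z hz := φ.norm_le_one _ (toHalfPlane_mem α hz)

/-! ### Positivity of the de Branges–Rovnyak kernels -/

section positivity

variable {U Y : Type*} [NormedAddCommGroup U] [InnerProductSpace ℂ U] [CompleteSpace U]
  [NormedAddCommGroup Y] [InnerProductSpace ℂ Y] [CompleteSpace Y]

theorem den_ne {R : ℝ} (hR : 0 < R) {w ζ : ℂ} (hw : ‖w‖ < R) (hζ : ‖ζ‖ ≤ R) :
    1 - ζ * conj w / (R : ℂ) ^ 2 ≠ 0 := by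
  intro h
  have h1 : ζ * conj w / (R : ℂ) ^ 2 = 1 := (sub_eq_zero.mp h).symm
  have h2 := congrArg norm h1
  simp only [norm_div, norm_mul, RCLike.norm_conj, norm_pow, norm_one, Complex.norm_real,
    Real.norm_eq_abs, abs_of_pos hR] at h2
  rw [div_eq_one_iff_eq (by positivity)] at h2
  nlinarith [norm_nonneg ζ, norm_nonneg w]

theorem circle_reproducing {E : Type*} [NormedAddCommGroup E] [InnerProductSpace ℂ E]
    {R : ℝ} (hR : 0 < R) {F : ℂ → E}
    (hF : DifferentiableOn ℂ F (Metric.closedBall 0 R)) {w : ℂ} (hw : ‖w‖ < R) (v : E) :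
    Real.circleAverage (fun ζ => ⟪(1 - ζ * conj w / (R : ℂ) ^ 2)⁻¹ • v, F ζ⟫_ℂ) 0 R
      = ⟪v, F w⟫_ℂ := by
  rw [Real.circleAverage_eq_circleIntegral (by exact hR.ne')]
  have key : (∮ z in C(0, R), (z - 0)⁻¹ • ⟪(1 - z * conj w / (R : ℂ) ^ 2)⁻¹ • v, F z⟫_ℂ)
      = ∮ z in C(0, R), (z - w)⁻¹ • ⟪v, F z⟫_ℂ := by
    apply circleIntegral.integral_congr hR.le
    intro z hz
    have hz' : ‖z‖ = R := by simpa using hz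
    have hz0 : z ≠ 0 := by
      rintro rfl; simp at hz'; exact hR.ne hz'
    have hzz : z * conj z = (R : ℂ) ^ 2 := by
      rw [Complex.mul_conj, Complex.normSq_eq_norm_sq, hz']; push_cast; rfl
    have hzw : z - w ≠ 0 := by
      intro h; rw [sub_eq_zero] at h; rw [← h, hz'] at hw; exact lt_irrefl _ hw
    have hcz : conj z ≠ 0 := by simpa using hz0
    simp only [inner_smul_left, map_inv₀, map_sub, map_one, map_div₀, map_mul, map_pow,
      Complex.conj_conj, Complex.conj_ofReal, smul_eq_mul, sub_zero]
    rw [← hzz]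
    have : (1 - conj z * w / (z * conj z)) = (z - w) / z := by field_simp
    rw [this]
    field_simp
  rw [key]
  have hd : DifferentiableOn ℂ (fun z => ⟪v, F z⟫_ℂ) (Metric.closedBall 0 R) :=
    (innerSL ℂ v).differentiable.comp_differentiableOn hF
  rw [DiffContOnCl.circleIntegral_sub_inv_smul (f := fun z => ⟪v, F z⟫_ℂ)
    (hd.diffContOnCl_ball (subset_refl _)) (by simpa using hw)]
  rw [inv_smul_smul₀]
  simp [Real.pi_ne_zero]

theorem kernelFun_differentiableOn {R : ℝ} (hR : 0 < R) {w : ℂ} (hw : ‖w‖ < R) :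
    DifferentiableOn ℂ (fun ζ : ℂ => (1 - ζ * conj w / (R : ℂ) ^ 2)⁻¹)
      (Metric.closedBall 0 R) := by
  apply DifferentiableOn.inv
  · fun_prop
  · intro ζ hζ
    exact den_ne hR hw (by simpa using hζ)

theorem circle_reproducing_sum {E : Type*} [NormedAddCommGroup E] [InnerProductSpace ℂ E]
    {R : ℝ} (hR : 0 < R) {ι : Type*} (s : Finset ι) (p : ι → ℂ) (a : ι → E)
    (hp : ∀ i ∈ s, ‖p i‖ < R) {F : ℂ → E}
    (hF : DifferentiableOn ℂ F (Metric.closedBall 0 R)) :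
    Real.circleAverage (fun ζ =>
      ⟪∑ i ∈ s, (1 - ζ * conj (p i) / (R : ℂ) ^ 2)⁻¹ • a i, F ζ⟫_ℂ) 0 R
      = ∑ i ∈ s, ⟪a i, F (p i)⟫_ℂ := by
  have csub : Metric.sphere (0 : ℂ) |R| ⊆ Metric.closedBall 0 R := by
    rw [abs_of_pos hR]; exact Metric.sphere_subset_closedBall
  simp only [sum_inner]
  rw [Real.circleAverage_fun_sum]
  · exact Finset.sum_congr rfl fun i hi => circle_reproducing hR hF (hp i hi) (a i)
  · intro i hi
    exact ContinuousOn.circleIntegrable' (((((kernelFun_differentiableOn hR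
      (hp i hi)).smul_const (a i)).continuousOn).inner hF.continuousOn).mono csub)

theorem kernel_sum_nonneg_aux (φ : Schur unitDisk U Y) {ι : Type*} (s : Finset ι)
    (p : ι → ℂ) (v : ι → Y) {R : ℝ} (hR : 0 < R) (hR1 : R < 1) (hp : ∀ i ∈ s, ‖p i‖ < R) :
    0 ≤ (∑ i ∈ s, ∑ j ∈ s, (1 - p i * conj (p j) / (R : ℂ) ^ 2)⁻¹ *
      ⟪v i, v j - φ.toFun (p i) ((φ.toFun (p j)).adjoint (v j))⟫_ℂ).re := by
  have hsub : Metric.closedBall (0 : ℂ) R ⊆ Metric.ball 0 1 :=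
    Metric.closedBall_subset_ball hR1
  have hk : ∀ j ∈ s, DifferentiableOn ℂ
      (fun ζ : ℂ => (1 - ζ * conj (p j) / (R : ℂ) ^ 2)⁻¹) (Metric.closedBall 0 R) :=
    fun j hj => kernelFun_differentiableOn hR (hp j hj)
  set k : ι → ℂ → ℂ := fun j ζ => (1 - ζ * conj (p j) / (R : ℂ) ^ 2)⁻¹ with hkdef
  set g : ι → U := fun j => (φ.toFun (p j)).adjoint (v j) with hg
  set q : ℂ → Y := fun ζ => ∑ j ∈ s, k j ζ • v j with hq
  set h : ℂ → U := fun ζ => ∑ j ∈ s, k j ζ • g j with hh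
  have dq : DifferentiableOn ℂ q (Metric.closedBall 0 R) :=
    DifferentiableOn.fun_sum fun j hj => (hk j hj).smul_const (v j)
  have dh : DifferentiableOn ℂ h (Metric.closedBall 0 R) :=
    DifferentiableOn.fun_sum fun j hj => (hk j hj).smul_const (g j)
  have dφ : DifferentiableOn ℂ φ.toFun (Metric.closedBall 0 R) := φ.differentiableOn.mono hsub
  have dφh : DifferentiableOn ℂ (fun ζ => φ.toFun ζ (h ζ)) (Metric.closedBall 0 R) :=
    dφ.clm_apply dh
  have csub : Metric.sphere (0 : ℂ) |R| ⊆ Metric.closedBall 0 R := by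
    rw [abs_of_pos hR]; exact Metric.sphere_subset_closedBall
  have ci : ∀ {f : ℂ → ℂ}, ContinuousOn f (Metric.closedBall 0 R) → CircleIntegrable f 0 R :=
    fun hf => ContinuousOn.circleIntegrable' (hf.mono csub)
  have aqq := circle_reproducing_sum hR s p v hp dq
  have aqh := circle_reproducing_sum hR s p v hp dφh
  have ahh := circle_reproducing_sum hR s p g hp dh
  have e1 : ∑ i ∈ s, ⟪g i, h (p i)⟫_ℂ = ∑ i ∈ s, ⟪v i, φ.toFun (p i) (h (p i))⟫_ℂ := by
    refine Finset.sum_congr rfl fun i _ => ?_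
    rw [hg, ContinuousLinearMap.adjoint_inner_left]
  rw [e1] at ahh
  have cqq : CircleIntegrable (fun ζ => ⟪q ζ, q ζ⟫_ℂ) 0 R :=
    ci (dq.continuousOn.inner dq.continuousOn)
  have cqh : CircleIntegrable (fun ζ => ⟪q ζ, φ.toFun ζ (h ζ)⟫_ℂ) 0 R :=
    ci (dq.continuousOn.inner dφh.continuousOn)
  have chh : CircleIntegrable (fun ζ => ⟪h ζ, h ζ⟫_ℂ) 0 R :=
    ci (dh.continuousOn.inner dh.continuousOn)
  have hre : ∀ {f : ℂ → ℂ}, CircleIntegrable f 0 R →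
      Real.circleAverage (fun ζ => (f ζ).re) 0 R = (Real.circleAverage f 0 R).re :=
    fun hf => Complex.reCLM.circleAverage_comp_comm hf
  have main : 0 ≤ Real.circleAverage (fun ζ => (⟪q ζ, q ζ⟫_ℂ - ⟪q ζ, φ.toFun ζ (h ζ)⟫_ℂ
      - ⟪q ζ, φ.toFun ζ (h ζ)⟫_ℂ + ⟪h ζ, h ζ⟫_ℂ).re) 0 R := by
    apply Real.circleAverage_nonneg_of_nonneg
    intro ζ hζ
    have hn : ‖φ.toFun ζ (h ζ)‖ ≤ ‖h ζ‖ := by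
      have := (φ.toFun ζ).le_of_opNorm_le (φ.norm_le_one ζ (hsub (csub hζ))) (h ζ)
      simpa using this
    have h0 := norm_sub_sq (𝕜 := ℂ) (q ζ) (φ.toFun ζ (h ζ))
    have hq2 := inner_self_eq_norm_sq (𝕜 := ℂ) (q ζ)
    have hh2 := inner_self_eq_norm_sq (𝕜 := ℂ) (h ζ)
    simp only [RCLike.re_eq_complex_re] at h0 hq2 hh2
    simp only [Complex.add_re, Complex.sub_re]
    rw [hq2, hh2]
    nlinarith [sq_nonneg ‖q ζ - φ.toFun ζ (h ζ)‖, norm_nonneg (φ.toFun ζ (h ζ))]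
  have e2 : Real.circleAverage ((((fun ζ => ⟪q ζ, q ζ⟫_ℂ) - fun ζ => ⟪q ζ, φ.toFun ζ (h ζ)⟫_ℂ)
      - fun ζ => ⟪q ζ, φ.toFun ζ (h ζ)⟫_ℂ) + fun ζ => ⟪h ζ, h ζ⟫_ℂ) 0 R
      = ∑ i ∈ s, ⟪v i, q (p i)⟫_ℂ - ∑ i ∈ s, ⟪v i, φ.toFun (p i) (h (p i))⟫_ℂ := by
    rw [Real.circleAverage_add ((cqq.sub cqh).sub cqh) chh,
      Real.circleAverage_sub (cqq.sub cqh) cqh, Real.circleAverage_sub cqq cqh]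
    rw [ahh, aqh, aqq]; ring
  have main := main.trans_eq
    ((hre (((cqq.sub cqh).sub cqh).add chh)).trans (congrArg Complex.re e2))
  rw [← Finset.sum_sub_distrib] at main
  convert main using 3 with i hi
  rw [← inner_sub_right, hq, hh]
  simp only [map_sum, map_smul, ← Finset.sum_sub_distrib, ← smul_sub, inner_sum, inner_smul_right]
  rfl

theorem disk_sum_nonneg (φ : Schur unitDisk U Y) {ι : Type*} (s : Finset ι)
    (p : ι → ℂ) (v : ι → Y) (hp : ∀ i ∈ s, ‖p i‖ < 1) :
    0 ≤ (∑ i ∈ s, ∑ j ∈ s, (1 - p i * conj (p j))⁻¹ *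
      ⟪v i, v j - φ.toFun (p i) ((φ.toFun (p j)).adjoint (v j))⟫_ℂ).re := by
  have lim : Filter.Tendsto (fun R : ℝ => (∑ i ∈ s, ∑ j ∈ s,
      (1 - p i * conj (p j) / (R : ℂ) ^ 2)⁻¹ *
      ⟪v i, v j - φ.toFun (p i) ((φ.toFun (p j)).adjoint (v j))⟫_ℂ).re) (nhdsWithin 1 (Set.Iio 1))
      (nhds (∑ i ∈ s, ∑ j ∈ s, (1 - p i * conj (p j) / ((1 : ℝ) : ℂ) ^ 2)⁻¹ *
      ⟪v i, v j - φ.toFun (p i) ((φ.toFun (p j)).adjoint (v j))⟫_ℂ).re) := by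
    refine Filter.Tendsto.mono_left (ContinuousAt.tendsto ?_) nhdsWithin_le_nhds
    refine Complex.continuous_re.continuousAt.comp ?_
    refine tendsto_finsetSum _ fun i hi => tendsto_finsetSum _ fun j hj => ?_
    refine ContinuousAt.mul ?_ continuousAt_const
    refine ContinuousAt.inv₀ ?_ ?_
    · refine continuousAt_const.sub (continuousAt_const.div ?_ (by norm_num))
      exact (Complex.continuous_ofReal.pow 2).continuousAt
    · exact den_ne one_pos (hp j hj) (hp i hi).le
  have h1 : ((1 : ℝ) : ℂ) ^ 2 = 1 := by norm_num
  simp only [h1, div_one] at lim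
  refine ge_of_tendsto lim ?_
  have hev : ∀ᶠ R : ℝ in nhdsWithin 1 (Set.Iio 1), ∀ i ∈ s, ‖p i‖ < R := by
    rw [Finset.eventually_all]
    exact fun i hi => eventually_nhdsWithin_of_eventually_nhds (lt_mem_nhds (hp i hi))
  have hpos : ∀ᶠ R : ℝ in nhdsWithin 1 (Set.Iio 1), 0 < R :=
    eventually_nhdsWithin_of_eventually_nhds (lt_mem_nhds one_pos)
  filter_upwards [hev, hpos, self_mem_nhdsWithin] with R h1 h2 h3
  exact kernel_sum_nonneg_aux φ s p v h2 h3 h1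
/-- The kernel `(1 - φ(z) φ(w)*) / (1 - z w̄)` on the unit disk. -/
noncomputable def diskKernel (φ : Schur unitDisk U Y) : Matrix unitDisk unitDisk (Y →L[ℂ] Y) :=
  .of fun z w => (1 - (z : ℂ) * conj (w : ℂ))⁻¹ •
    (1 - φ.toFun z ∘L (φ.toFun w).adjoint)

/-- The kernel `K_o(μ, ν) = (1 - φ(μ) φ(ν)*) / (μ + ν̄)` on the right half-plane. -/
noncomputable def halfPlaneKernel (φ : Schur rightHalfPlane U Y) :
    Matrix rightHalfPlane rightHalfPlane (Y →L[ℂ] Y) :=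
  .of fun μ ν => ((μ : ℂ) + conj (ν : ℂ))⁻¹ •
    (1 - φ.toFun μ ∘L (φ.toFun ν).adjoint)

theorem posSemidef_of_sum {X : Type*} {K : Matrix X X (Y →L[ℂ] Y)} (hK : K.IsHermitian)
    (h : ∀ (s : Finset X) (v : X → Y), 0 ≤ (∑ i ∈ s, ∑ j ∈ s, ⟪v i, K i j (v j)⟫_ℂ).re) :
    K.PosSemidef := by
  refine (RKHS.posSemidef_tfae (K := K).out 0 2).mpr (And.intro hK fun vv => ?_)
  have h1 := h vv.support vv
  rw [Finset.sum_comm] at h1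
  have h2 : (vv.sum fun x w => vv.sum fun x' w' => ⟪K x' x w, w'⟫_ℂ)
      = conj (∑ j ∈ vv.support, ∑ i ∈ vv.support, ⟪vv i, K i j (vv j)⟫_ℂ) := by
    simp only [Finsupp.sum, map_sum, inner_conj_symm]
  rw [h2]
  exact h1.trans_eq (Complex.conj_re _).symm

theorem diskKernel_posSemidef (φ : Schur unitDisk U Y) : (diskKernel φ).PosSemidef := by
  refine posSemidef_of_sum ?_ fun s v => ?_
  · ext1 z w
    simp only [Matrix.conjTranspose_apply, diskKernel, Matrix.of_apply, star_smul, star_sub,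
      star_one, star_inv₀, star_mul', RCLike.star_def, Complex.conj_conj]
    congr 1
    · simp [mul_comm]
    · simp [ContinuousLinearMap.star_eq_adjoint, ContinuousLinearMap.adjoint_comp]
  · have h := disk_sum_nonneg φ s (fun z => (z : ℂ)) v
      (fun z _ => by simpa [unitDisk] using z.2)
    convert h using 5 with i _ j _
    simp [diskKernel]

theorem halfPlaneKernel_posSemidef (φ : Schur rightHalfPlane U Y) :
    (halfPlaneKernel φ).PosSemidef := by
  refine posSemidef_of_sum ?_ fun s v => ?_
  · ext1 z w
    simp only [Matrix.conjTranspose_apply, halfPlaneKernel, Matrix.of_apply, star_smul, star_sub,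
      star_one, star_inv₀, star_add, RCLike.star_def, Complex.conj_conj]
    congr 1
    · simp [add_comm]
    · simp [ContinuousLinearMap.star_eq_adjoint, ContinuousLinearMap.adjoint_comp]
  · let a : rightHalfPlane := ⟨1, by simp [rightHalfPlane]⟩
    have h := disk_sum_nonneg (φ.onDisk a) s (fun μ => (toDisk a μ : ℂ))
      (fun μ => ((Real.sqrt 2 : ℂ) / (1 + conj (μ : ℂ))) • v μ)
      (fun μ _ => by simpa [unitDisk] using (toDisk a μ).2)
    convert h using 5 with i _ j _
    have hφ : ∀ μ : rightHalfPlane, (φ.onDisk a).toFun (toDisk a μ) = φ.toFun μ := fun μ =>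
      congrArg (fun ν : rightHalfPlane => φ.toFun ν) (toHalfPlane_toDisk a μ)
    have hi : (1 : ℂ) + i ≠ 0 := by simpa [a] using conj_add_ne_zero a i
    have hj : (1 : ℂ) + conj (j : ℂ) ≠ 0 := by
      have := (map_ne_zero (starRingEnd ℂ)).mpr (conj_add_ne_zero a j)
      simpa [a] using this
    have hij : (i : ℂ) + conj (j : ℂ) ≠ 0 := by
      have := conj_add_ne_zero j i
      rwa [add_comm] at this
    have h2 : (Real.sqrt 2 : ℂ) * Real.sqrt 2 = 2 := by
      rw [← Complex.ofReal_mul, Real.mul_self_sqrt (by norm_num)]; norm_num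
    have hk : (1 - (toDisk a i : ℂ) * conj (toDisk a j : ℂ))⁻¹ *
        ((Real.sqrt 2 : ℂ) / (1 + i) * ((Real.sqrt 2 : ℂ) / (1 + conj (j : ℂ))))
        = ((i : ℂ) + conj (j : ℂ))⁻¹ := by
      have : 1 - (toDisk a i : ℂ) * conj (toDisk a j : ℂ)
          = 2 * ((i : ℂ) + conj (j : ℂ)) / ((1 + i) * (1 + conj (j : ℂ))) := by
        simp only [toDisk, a, map_one, map_div₀, map_sub, map_add]
        field_simp
        ring
      rw [this, div_mul_div_comm, h2]
      field_simp
    simp only [hφ, map_smul, ← smul_sub, inner_smul_left, inner_smul_right, halfPlaneKernel,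
      Matrix.of_apply, smul_apply, sub_apply,
      one_apply_eq_self, ContinuousLinearMap.comp_apply]
    rw [← hk]
    simp
    ring

instance (φ : Schur unitDisk U Y) : Fact (diskKernel φ).PosSemidef :=
  ⟨diskKernel_posSemidef φ⟩

instance (φ : Schur rightHalfPlane U Y) : Fact (halfPlaneKernel φ).PosSemidef :=
  ⟨halfPlaneKernel_posSemidef φ⟩

end positivity

/-! ### The de Branges–Rovnyak spaces -/

section spaces

variable {U Y : Type*} [NormedAddCommGroup U] [InnerProductSpace ℂ U] [CompleteSpace U]
  [NormedAddCommGroup Y] [InnerProductSpace ℂ Y] [CompleteSpace Y]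

/-- The Hilbert space of `Y`-valued functions on the unit disk with reproducing kernel
`diskKernel φ`. -/
def DiskSpace (φ : Schur unitDisk U Y) : Type _ := RKHS.OfKernel (diskKernel φ)

noncomputable instance (φ : Schur unitDisk U Y) : NormedAddCommGroup (DiskSpace φ) :=
  inferInstanceAs (NormedAddCommGroup (RKHS.OfKernel (diskKernel φ)))

noncomputable instance (φ : Schur unitDisk U Y) : InnerProductSpace ℂ (DiskSpace φ) :=
  inferInstanceAs (InnerProductSpace ℂ (RKHS.OfKernel (diskKernel φ)))

instance (φ : Schur unitDisk U Y) : CompleteSpace (DiskSpace φ) :=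
  inferInstanceAs (CompleteSpace (RKHS.OfKernel (diskKernel φ)))

noncomputable instance (φ : Schur unitDisk U Y) : RKHS ℂ (DiskSpace φ) unitDisk Y :=
  inferInstanceAs (RKHS ℂ (RKHS.OfKernel (diskKernel φ)) unitDisk Y)

theorem kernel_diskSpace (φ : Schur unitDisk U Y) :
    RKHS.kernel (DiskSpace φ) = diskKernel φ :=
  RKHS.OfKernel.kernel_ofKernel (K := diskKernel φ)

/-- The Hilbert space `H_o` of `Y`-valued functions on the right half-plane with reproducing
kernel `halfPlaneKernel φ`. -/
def HalfPlaneSpace (φ : Schur rightHalfPlane U Y) : Type _ := RKHS.OfKernel (halfPlaneKernel φ)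

noncomputable instance (φ : Schur rightHalfPlane U Y) : NormedAddCommGroup (HalfPlaneSpace φ) :=
  inferInstanceAs (NormedAddCommGroup (RKHS.OfKernel (halfPlaneKernel φ)))

noncomputable instance (φ : Schur rightHalfPlane U Y) :
    InnerProductSpace ℂ (HalfPlaneSpace φ) :=
  inferInstanceAs (InnerProductSpace ℂ (RKHS.OfKernel (halfPlaneKernel φ)))

instance (φ : Schur rightHalfPlane U Y) : CompleteSpace (HalfPlaneSpace φ) :=
  inferInstanceAs (CompleteSpace (RKHS.OfKernel (halfPlaneKernel φ)))

noncomputable instance (φ : Schur rightHalfPlane U Y) :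
    RKHS ℂ (HalfPlaneSpace φ) rightHalfPlane Y :=
  inferInstanceAs (RKHS ℂ (RKHS.OfKernel (halfPlaneKernel φ)) rightHalfPlane Y)

theorem kernel_halfPlaneSpace (φ : Schur rightHalfPlane U Y) :
    RKHS.kernel (HalfPlaneSpace φ) = halfPlaneKernel φ :=
  RKHS.OfKernel.kernel_ofKernel (K := halfPlaneKernel φ)

/-- Elements of `H_o` tend to zero as the real part of the argument tends to infinity. -/
theorem tendsto_zero (φ : Schur rightHalfPlane U Y) (x : HalfPlaneSpace φ) :
    Filter.Tendsto (fun η : rightHalfPlane => x η)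
      (Filter.comap (fun η : rightHalfPlane => (η : ℂ).re) Filter.atTop) (nhds 0) := by
  have hb : ∀ η : rightHalfPlane, ‖x η‖ ≤ ‖x‖ * √(((η : ℂ).re)⁻¹) := by
    intro η
    have hη : 0 < (η : ℂ).re := η.2
    refine (RKHS.norm_apply_le x η).trans ?_
    gcongr
    rw [kernel_halfPlaneSpace]
    simp only [halfPlaneKernel, Matrix.of_apply]
    rw [norm_smul, Complex.add_conj, norm_inv, Complex.norm_real, Real.norm_eq_abs,
      abs_of_pos (by positivity)]
    have h1 : ‖φ.toFun η ∘L (φ.toFun η).adjoint‖ ≤ 1 := by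
      refine (ContinuousLinearMap.opNorm_comp_le _ _).trans ?_
      rw [LinearIsometryEquiv.norm_map]
      have := φ.norm_le_one η η.2
      nlinarith [norm_nonneg (φ.toFun η)]
    have h2 : ‖(1 : Y →L[ℂ] Y) - φ.toFun η ∘L (φ.toFun η).adjoint‖ ≤ 2 := by
      refine (norm_sub_le _ _).trans ?_
      have : ‖(1 : Y →L[ℂ] Y)‖ ≤ 1 := ContinuousLinearMap.norm_id_le
      linarith
    calc _ ≤ (2 * (η : ℂ).re)⁻¹ * 2 := by gcongr
      _ = _ := by field_simp
  refine squeeze_zero_norm hb ?_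
  have h0 : Filter.Tendsto (fun t : ℝ => ‖x‖ * √(t⁻¹)) Filter.atTop (nhds 0) := by
    have := (Real.continuous_sqrt.tendsto 0).comp tendsto_inv_atTop_zero
    simpa using this.const_mul ‖x‖
  exact h0.comp Filter.tendsto_comap

end spaces

/-! ### System nodes and the internal Cayley transform -/

section unbounded

variable {X : Type*} [NormedAddCommGroup X] [InnerProductSpace ℂ X]

/-- The inverse of a bijective linear map (and `0` if the map is not bijective). -/
noncomputable def linInv {E F : Type*} [AddCommGroup E] [Module ℂ E] [AddCommGroup F] [Module ℂ F]
    (f : E →ₗ[ℂ] F) : F →ₗ[ℂ] E :=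
  open Classical in
  if h : Function.Bijective f then (LinearEquiv.ofBijective f h).symm else 0

/-- The map `μ - A` on the domain of the operator `A`. -/
def shift (A : X →ₗ.[ℂ] X) (μ : ℂ) : A.domain →ₗ[ℂ] X := μ • A.domain.subtype - A.toFun

/-- The resolvent set of `A`: those `μ` such that `μ - A` maps `dom A` one-to-one onto `X`. -/
def resSet (A : X →ₗ.[ℂ] X) : Set ℂ := {μ | Function.Bijective (shift A μ)}

/-- The resolvent `(μ - A)⁻¹ : X → dom A`, for `μ` in the resolvent set. -/
noncomputable def resolventMap (A : X →ₗ.[ℂ] X) (μ : ℂ) : X →ₗ[ℂ] A.domain := linInv (shift A μ)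

/-- `A` is the infinitesimal generator of a strongly continuous semigroup `T(t)`, `t ≥ 0`. -/
def IsC0Generator (A : X →ₗ.[ℂ] X) : Prop :=
  ∃ T : ℝ → X →L[ℂ] X,
    T 0 = 1 ∧
    (∀ s t : ℝ, 0 ≤ s → 0 ≤ t → T (s + t) = T s ∘L T t) ∧
    (∀ x : X, Filter.Tendsto (fun t : ℝ => T t x) (nhdsWithin 0 (Set.Ioi 0)) (nhds x)) ∧
    ∀ x z : X, (x, z) ∈ A.graph ↔
      Filter.Tendsto (fun t : ℝ => ((t⁻¹ : ℝ) : ℂ) • (T t x - x))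
        (nhdsWithin 0 (Set.Ioi 0)) (nhds z)

/-- The space `X`, to be equipped with the norm `‖x‖₋₁ = ‖(β - A)⁻¹ x‖`. -/
def PreExtrapolation (_A : X →ₗ.[ℂ] X) (_β : ℂ) : Type _ := X

instance (A : X →ₗ.[ℂ] X) (β : ℂ) : AddCommGroup (PreExtrapolation A β) :=
  inferInstanceAs (AddCommGroup X)

instance (A : X →ₗ.[ℂ] X) (β : ℂ) : Module ℂ (PreExtrapolation A β) :=
  inferInstanceAs (Module ℂ X)

/-- The resolvent `(β - A)⁻¹` seen as a map on `PreExtrapolation A β`. -/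
noncomputable def preResolvent (A : X →ₗ.[ℂ] X) (β : ℂ) : PreExtrapolation A β →ₗ[ℂ] X :=
  A.domain.subtype ∘ₗ (resolventMap A β : X →ₗ[ℂ] A.domain)

noncomputable instance (A : X →ₗ.[ℂ] X) (β : ℂ) :
    SeminormedAddCommGroup (PreExtrapolation A β) :=
  SeminormedAddCommGroup.induced _ _ (preResolvent A β)

noncomputable instance (A : X →ₗ.[ℂ] X) (β : ℂ) : NormedSpace ℂ (PreExtrapolation A β) :=
  NormedSpace.induced ℂ _ _ (preResolvent A β)

theorem norm_preExtrapolation (A : X →ₗ.[ℂ] X) (β : ℂ) (x : PreExtrapolation A β) :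
    ‖x‖ = ‖((resolventMap A β x : A.domain) : X)‖ := rfl

/-- The extrapolation space `X₋₁`: the completion of `X` in the norm `‖(β - A)⁻¹ x‖`. -/
abbrev Extrapolation (A : X →ₗ.[ℂ] X) (β : ℂ) : Type _ :=
  UniformSpace.Completion (PreExtrapolation A β)

/-- The canonical embedding of `X` into `X₋₁`. -/
noncomputable def toExtrapolation (A : X →ₗ.[ℂ] X) (β : ℂ) : X →ₗ[ℂ] Extrapolation A β :=
  (UniformSpace.Completion.toComplₗᵢ (𝕜 := ℂ) (E := PreExtrapolation A β)).toLinearMap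

end unbounded

section nodes

variable {X U Y : Type*} [NormedAddCommGroup X] [InnerProductSpace ℂ X]
  [NormedAddCommGroup U] [InnerProductSpace ℂ U] [NormedAddCommGroup Y] [InnerProductSpace ℂ Y]

/-- The main operator `A x = [A&B] (x, 0)`, with domain `{x | (x, 0) ∈ dom S}`. -/
def mainOp (S : X × U →ₗ.[ℂ] X × Y) : X →ₗ.[ℂ] X where
  domain := S.domain.comap (LinearMap.inl ℂ X U)
  toFun := LinearMap.fst ℂ X Y ∘ₗ S.toFun ∘ₗ
    (LinearMap.inl ℂ X U).restrict (p := S.domain.comap (LinearMap.inl ℂ X U)) (q := S.domain)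
      fun _ h => h

/-- The observation operator `C x = [C&D] (x, 0)` on the domain of the main operator. -/
def observationOp (S : X × U →ₗ.[ℂ] X × Y) : (mainOp S).domain →ₗ[ℂ] Y :=
  LinearMap.snd ℂ X Y ∘ₗ S.toFun ∘ₗ
    (LinearMap.inl ℂ X U).restrict (p := S.domain.comap (LinearMap.inl ℂ X U)) (q := S.domain)
      fun _ h => h

/-- `T = [A|_X  B]` is a continuous extension of `[A&B]` to an operator from `X × U` to `X₋₁`.
Its two components `T (x, 0)` and `T (0, u)` are `A|_X x` and `B u`. -/
def IsRiggedExtension (S : X × U →ₗ.[ℂ] X × Y) (β : ℂ)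
    (T : X × U →L[ℂ] Extrapolation (mainOp S) β) : Prop :=
  ∀ v : S.domain, T v = toExtrapolation (mainOp S) β (S v).1

/-- System nodes on `(U, X, Y)`. -/
structure IsSystemNode (S : X × U →ₗ.[ℂ] X × Y) : Prop where
  isClosed : S.IsClosed
  generator : IsC0Generator (mainOp S)
  rigged : ∀ β ∈ resSet (mainOp S), ∃ T : X × U →L[ℂ] Extrapolation (mainOp S) β,
    IsRiggedExtension S β T ∧
    ∀ v : X × U, v ∈ S.domain ↔ T v ∈ LinearMap.range (toExtrapolation (mainOp S) β)

/-- The operator `(α - A|_X)⁻¹ B : U → X`, computed from `T = [A|_X  B]`. -/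
noncomputable def extrapolatedResolventB (S : X × U →ₗ.[ℂ] X × Y) (β α : ℂ)
    (T : X × U →L[ℂ] Extrapolation (mainOp S) β) (u : U) : X :=
  linInv (α • toExtrapolation (mainOp S) β - T.toLinearMap ∘ₗ LinearMap.inl ℂ X U) (T (0, u))

/-- The operators `cA, cB, cC, cD` form the internal Cayley transform with parameter `α` of the
system node `S`:
`cA = (ᾱ + A)(α - A)⁻¹`, `cB = √(2 Re α) (α - A|_X)⁻¹ B`, `cC = √(2 Re α) C (α - A)⁻¹`, and `cD` is
the value at `α` of the transfer function, `cD u = [C&D] ((α - A|_X)⁻¹ B u, u)`.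
The parameter `β` used to norm `X₋₁` is arbitrary in the resolvent set of `A`. -/
structure IsInternalCayleyTransform (S : X × U →ₗ.[ℂ] X × Y) (α : ℂ) (cA : X →L[ℂ] X)
    (cB : U →L[ℂ] X) (cC : X →L[ℂ] Y) (cD : U →L[ℂ] Y) : Prop where
  node : IsSystemNode S
  mem_resSet : α ∈ resSet (mainOp S)
  A_eq : ∀ x : X, cA x = conj α • ((resolventMap (mainOp S) α x : (mainOp S).domain) : X)
    + mainOp S (resolventMap (mainOp S) α x)
  B_eq : ∀ β ∈ resSet (mainOp S), ∀ T, IsRiggedExtension S β T → ∀ u : U,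
    cB u = (√(2 * α.re) : ℂ) • extrapolatedResolventB S β α T u
  C_eq : ∀ x : X, cC x = (√(2 * α.re) : ℂ) • observationOp S (resolventMap (mainOp S) α x)
  D_eq : ∀ β ∈ resSet (mainOp S), ∀ T, IsRiggedExtension S β T → ∀ u : U,
    ∃ h : (extrapolatedResolventB S β α T u, u) ∈ S.domain, cD u = (S ⟨_, h⟩).2

end nodes

/-! ### The two canonical models -/

section models

variable {U Y : Type*} [NormedAddCommGroup U] [InnerProductSpace ℂ U] [CompleteSpace U]
  [NormedAddCommGroup Y] [InnerProductSpace ℂ Y] [CompleteSpace Y]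

/-- The graph of the observable co-energy-preserving model: all `((x, u), (z, y))` with
`z(μ) = μ x(μ) + φ(μ) u - y` for all `μ` in the right half-plane. -/
def obsGraph (φ : Schur rightHalfPlane U Y) :
    Submodule ℂ ((HalfPlaneSpace φ × U) × (HalfPlaneSpace φ × Y)) where
  carrier := {p | ∀ μ : rightHalfPlane,
    p.2.1 μ = (μ : ℂ) • p.1.1 μ + φ.toFun μ p.1.2 - p.2.2}
  zero_mem' μ := by simp
  add_mem' {p q} hp hq μ := by
    simp only [Prod.snd_add, Prod.fst_add, RKHS.coe_add, Pi.add_apply, hp μ, hq μ, map_add,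
      smul_add]
    abel
  smul_mem' c p hp μ := by
    simp only [Prod.smul_snd, Prod.smul_fst, RKHS.coe_smul, Pi.smul_apply, hp μ, map_smul,
      smul_add, smul_sub, smul_comm c]

/-- The canonical observable co-energy-preserving model of `φ`, as an unbounded operator from
`H_o × U` to `H_o × Y`: its domain consists of the `(x, u)` for which there is `y ∈ Y` such that
`z(μ) = μ x(μ) + φ(μ) u - y` belongs to `H_o`, and it maps `(x, u)` to `(z, y)`; the vector `y` is
unique. -/
noncomputable def obsNode (φ : Schur rightHalfPlane U Y) :
    HalfPlaneSpace φ × U →ₗ.[ℂ] HalfPlaneSpace φ × Y :=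
  (obsGraph φ).toLinearPMap

/-- The vector `y` in the definition of the model is `lim (η x(η) + φ(η) u)` as `Re η → ∞`. -/
theorem tendsto_of_mem_obsGraph (φ : Schur rightHalfPlane U Y) {x z : HalfPlaneSpace φ} {u : U}
    {y : Y} (h : ((x, u), (z, y)) ∈ obsGraph φ) :
    Filter.Tendsto (fun η : rightHalfPlane => (η : ℂ) • x η + φ.toFun η u)
      (Filter.comap (fun η : rightHalfPlane => (η : ℂ).re) Filter.atTop) (nhds y) := by
  have h0 := (tendsto_zero φ z).add_const y
  rw [zero_add] at h0
  refine h0.congr fun η => ?_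
  have h1 : z η = (η : ℂ) • x η + φ.toFun η u - y := h η
  rw [h1]
  abel

theorem graph_obsNode (φ : Schur rightHalfPlane U Y) : (obsNode φ).graph = obsGraph φ := by
  refine Submodule.toLinearPMap_graph_eq _ ?_
  rintro ⟨⟨x, u⟩, ⟨z, y⟩⟩ hp h0
  simp only [Prod.mk_eq_zero] at h0
  obtain ⟨rfl, rfl⟩ := h0
  have hy := tendsto_of_mem_obsGraph φ hp
  have hne : (Filter.comap (fun η : rightHalfPlane => (η : ℂ).re) Filter.atTop).NeBot := by
    rw [Filter.comap_neBot_iff]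
    intro t ht
    obtain ⟨a, ha⟩ := Filter.mem_atTop_sets.mp ht
    exact ⟨⟨((max a 1 : ℝ) : ℂ), by simp [rightHalfPlane]⟩, ha _ (by simp)⟩
  have hy0 : y = 0 := by
    refine tendsto_nhds_unique hy ?_
    simp
  subst hy0
  have hz : z = 0 := by
    ext μ
    have h1 : z μ = (μ : ℂ) • (0 : HalfPlaneSpace φ) μ + φ.toFun μ 0 - 0 := hp μ
    simpa using h1
  rw [hz]
  rfl

/-- `f` is given by the formula `g` away from the point `a`, where `g` has a removable singularity,
and `f a` is the limit of `g` at `a`. -/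
def IsRemovableExtension {Ω : Set ℂ} {E : Type*} [NormedAddCommGroup E] (f g : Ω → E) (a : Ω) :
    Prop :=
  (∀ z : Ω, z ≠ a → f z = g z) ∧ Filter.Tendsto g (nhdsWithin a {a}ᶜ) (nhds (f a))

/-- The origin of the unit disk. -/
def diskZero : unitDisk := ⟨0, by simp [unitDisk]⟩

/-- The bounded operators `A, B, C, D` form the classical observable de Branges–Rovnyak model of
the Schur function `φ` on the disk:
`(A f)(z) = (f(z) - f(0)) / z`, `(B u)(z) = ((φ(z) - φ(0)) / z) u`, `C f = f(0)`, `D u = φ(0) u`. -/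
structure IsDiskModel (φ : Schur unitDisk U Y) (A : DiskSpace φ →L[ℂ] DiskSpace φ)
    (B : U →L[ℂ] DiskSpace φ) (C : DiskSpace φ →L[ℂ] Y) (D : U →L[ℂ] Y) : Prop where
  A_apply : ∀ f : DiskSpace φ,
    IsRemovableExtension (A f) (fun z => (z : ℂ)⁻¹ • (f z - f diskZero)) diskZero
  B_apply : ∀ u : U,
    IsRemovableExtension (B u) (fun z => (z : ℂ)⁻¹ • (φ.toFun z u - φ.toFun 0 u)) diskZero
  C_apply : ∀ f : DiskSpace φ, C f = f diskZero
  D_apply : ∀ u : U, D u = φ.toFun 0 u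

/-- The explicit formulas for the Cayley transform of the observable half-plane model:
`(cA x)(μ) = ((ᾱ + μ) / (α - μ)) x(μ) - (2 Re α / (α - μ)) x(α)`,
`(cB u)(μ) = √(2 Re α) ((φ(μ) - φ(α)) / (α - μ)) u`,
`cC x = √(2 Re α) x(α)` and `cD u = φ(α) u`. -/
structure IsExplicitCayley (φ : Schur rightHalfPlane U Y) (α : rightHalfPlane)
    (cA : HalfPlaneSpace φ →L[ℂ] HalfPlaneSpace φ) (cB : U →L[ℂ] HalfPlaneSpace φ)
    (cC : HalfPlaneSpace φ →L[ℂ] Y) (cD : U →L[ℂ] Y) : Prop where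
  A_apply : ∀ x : HalfPlaneSpace φ, IsRemovableExtension (cA x)
    (fun μ => ((conj (α : ℂ) + μ) / ((α : ℂ) - μ)) • x μ
      - ((2 * (α : ℂ).re : ℝ) / ((α : ℂ) - μ) : ℂ) • x α) α
  B_apply : ∀ u : U, IsRemovableExtension (cB u)
    (fun μ => ((√(2 * (α : ℂ).re) : ℂ) * ((α : ℂ) - μ)⁻¹) •
      (φ.toFun μ u - φ.toFun α u)) α
  C_apply : ∀ x : HalfPlaneSpace φ, cC x = (√(2 * (α : ℂ).re) : ℂ) • x α
  D_apply : ∀ u : U, cD u = φ.toFun α u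

end models

end DBR

/-!
The disk kernel satisfies `(1 - z w̄) K(z, w) = 1 - φ(z) φ(w)*`. Read as an equality of Gram
matrices, this says that `(w̄ k_w y, y) ↦ (k_w y, φ(w)* y)` extends to an isometry from `H ⊕ Y` to
`H ⊕ U`. Its adjoint `[A B; C D]` is characterized by `z g(z) + h = f(z) + φ(z) u` for
`(g, h) = (A f + B u, C f + D u)`, which at `z = 0` and away from it is the disk model
(`exists_isDiskColligation`). The half-plane kernel is the disk kernel up to the change of variable
`z_α` and a scalar multiplier, so the operator `Ξ` is unitary (`exists_diskSpace_equiv`), and `Ξ`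
turns the relation above into
`(α - μ) x'(μ) + √(2 Re α) h = (ᾱ + μ) x(μ) + √(2 Re α) φ(μ) u`. This relation gives the explicit
formulas, and it also parametrizes the graph of the half-plane model by
`((x + x', √(2 Re α) u), (α x' - ᾱ x, √(2 Re α) h))`
(`IsHalfPlaneColligation.mem_graph_obsNode`), which is the Cayley transform.

The main operator `A` of the half-plane model has every `α` in its resolvent set and is dissipative
because its Cayley transform is a contraction, so it generates a semigroup by the Lumer–Phillips
theorem (`isC0Generator_of_dissipative`), proved by Yosida approximation. For the extrapolation
space, `(β - A)⁻¹` extends to a unitary operator from `X₋₁` onto `X`, and statements about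
`[A|_X  B]` become statements about the bounded operator `(β - A|_X)⁻¹ [A|_X  B]` on `X × U`, which
is explicit in terms of `(β - A)⁻¹` and `G = (α - A|_X)⁻¹ B` (`resolventNode`). Here `G` is
recognized by the fact that the node maps `(G u, u)` to a pair with first component `α G u`.
-/

namespace DBR

/-! ### Isometries defined by Gram matrices -/

section gram

variable {E F : Type*} [NormedAddCommGroup E] [InnerProductSpace ℂ E] [CompleteSpace E]
  [NormedAddCommGroup F] [InnerProductSpace ℂ F] [CompleteSpace F] {ι : Type*}

/-- Two families with the same Gram matrix, the first of them total, are matched by a linear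
isometry. -/
theorem exists_linearIsometry_of_gram_eq (a : ι → E) (b : ι → F)
    (hgram : ∀ i j, ⟪a i, a j⟫_ℂ = ⟪b i, b j⟫_ℂ) (htot : ∀ x, (∀ i, ⟪a i, x⟫_ℂ = 0) → x = 0) :
    ∃ V : E →ₗᵢ[ℂ] F, ∀ i, V (a i) = b i := by
  have hnorm : ∀ v : ι →₀ ℂ,
      ‖Finsupp.linearCombination ℂ b v‖ = ‖Finsupp.linearCombination ℂ a v‖ := by
    intro v
    have : ⟪Finsupp.linearCombination ℂ b v, Finsupp.linearCombination ℂ b v⟫_ℂ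
        = ⟪Finsupp.linearCombination ℂ a v, Finsupp.linearCombination ℂ a v⟫_ℂ := by
      simp only [Finsupp.linearCombination_apply, Finsupp.sum_inner, Finsupp.inner_sum,
        inner_smul_left, inner_smul_right, hgram]
    rw [inner_self_eq_norm_sq_to_K, inner_self_eq_norm_sq_to_K] at this
    have h2 : ‖Finsupp.linearCombination ℂ b v‖ ^ 2 = ‖Finsupp.linearCombination ℂ a v‖ ^ 2 := by
      exact_mod_cast this
    exact (sq_eq_sq₀ (norm_nonneg _) (norm_nonneg _)).mp h2
  have hdense : DenseRange (Finsupp.linearCombination ℂ a) := by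
    have h1 : (Submodule.span ℂ (Set.range a)).topologicalClosure = ⊤ := by
      rw [Submodule.topologicalClosure_eq_top_iff, Submodule.eq_bot_iff]
      intro x hx
      refine htot x fun i => ?_
      exact (Submodule.mem_orthogonal _ _).mp hx _ (Submodule.subset_span ⟨i, rfl⟩)
    rw [← Finsupp.range_linearCombination] at h1
    have h2 := Submodule.dense_iff_topologicalClosure_eq_top.mpr h1
    exact h2
  have hb : ∀ v, ‖Finsupp.linearCombination ℂ b v‖ ≤ 1 * ‖Finsupp.linearCombination ℂ a v‖ :=
    fun v => by rw [hnorm, one_mul]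
  set V := (Finsupp.linearCombination ℂ b).extendOfNorm (Finsupp.linearCombination ℂ a)
  have hV : ∀ v, V (Finsupp.linearCombination ℂ a v) = Finsupp.linearCombination ℂ b v :=
    LinearMap.extendOfNorm_eq hdense ⟨1, hb⟩
  refine ⟨⟨V.toLinearMap, fun x => ?_⟩, fun i => ?_⟩
  · refine hdense.induction_on (p := fun x => ‖V.toLinearMap x‖ = ‖x‖) x ?_ fun v => ?_
    · exact isClosed_eq (by fun_prop) (by fun_prop)
    · simp [hV, hnorm]
  · simpa using hV (Finsupp.single i 1)

/-- Two total families with the same Gram matrix are matched by a unitary operator. -/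
theorem exists_linearIsometryEquiv_of_gram_eq (a : ι → E) (b : ι → F)
    (hgram : ∀ i j, ⟪a i, a j⟫_ℂ = ⟪b i, b j⟫_ℂ) (ha : ∀ x, (∀ i, ⟪a i, x⟫_ℂ = 0) → x = 0)
    (hb : ∀ x, (∀ i, ⟪b i, x⟫_ℂ = 0) → x = 0) :
    ∃ V : E ≃ₗᵢ[ℂ] F, ∀ i, V (a i) = b i := by
  obtain ⟨V, hV⟩ := exists_linearIsometry_of_gram_eq a b hgram ha
  refine ⟨LinearIsometryEquiv.ofSurjective V fun y => ?_, hV⟩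
  refine ⟨V.toContinuousLinearMap.adjoint y, ?_⟩
  rw [← sub_eq_zero]
  refine hb _ fun i => ?_
  rw [inner_sub_right, ← hV, V.inner_map_map, ContinuousLinearMap.adjoint_inner_right]
  exact sub_self _

end gram

/-! ### Reproducing kernel Hilbert spaces: change of variable and continuity -/

section rkhs

variable {V : Type*} [NormedAddCommGroup V] [InnerProductSpace ℂ V] [CompleteSpace V]

theorem eq_zero_of_inner_kerFun {X H : Type*} [NormedAddCommGroup H] [InnerProductSpace ℂ H]
    [CompleteSpace H] [RKHS ℂ H X V] (f : H)
    (h : ∀ x v, ⟪RKHS.kerFun H x v, f⟫_ℂ = 0) : f = 0 := by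
  ext x
  refine ext_inner_left ℂ fun v => ?_
  rw [← RKHS.kerFun_inner, h]
  simp

theorem inner_kerFun_kerFun {X H : Type*} [NormedAddCommGroup H] [InnerProductSpace ℂ H]
    [CompleteSpace H] [RKHS ℂ H X V] (x y : X) (v w : V) :
    ⟪RKHS.kerFun H x v, RKHS.kerFun H y w⟫_ℂ = ⟪v, RKHS.kernel H x y w⟫_ℂ := by
  rw [RKHS.kerFun_inner, RKHS.kerFun_apply]

/-- If the kernels of two reproducing kernel Hilbert spaces differ by a change of variable `e` and a
nowhere vanishing scalar multiplier `c`, then `f ↦ c • (f ∘ e)` is unitary between the spaces. -/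
theorem exists_unitary_of_kernel_eq {X₁ X₂ H₁ H₂ : Type*}
    [NormedAddCommGroup H₁] [InnerProductSpace ℂ H₁] [CompleteSpace H₁] [RKHS ℂ H₁ X₁ V]
    [NormedAddCommGroup H₂] [InnerProductSpace ℂ H₂] [CompleteSpace H₂] [RKHS ℂ H₂ X₂ V]
    {e : X₂ → X₁} (he : Function.Surjective e) {c : X₂ → ℂ} (hc : ∀ x, c x ≠ 0)
    (hK : ∀ x y, RKHS.kernel H₂ x y = (c x * conj (c y)) • RKHS.kernel H₁ (e x) (e y)) :
    ∃ W : H₁ ≃ₗᵢ[ℂ] H₂, ∀ f x, W f x = c x • f (e x) := by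
  have hgram : ∀ p q : X₂ × V, ⟪RKHS.kerFun H₁ (e p.1) (conj (c p.1) • p.2),
      RKHS.kerFun H₁ (e q.1) (conj (c q.1) • q.2)⟫_ℂ
      = ⟪RKHS.kerFun H₂ p.1 p.2, RKHS.kerFun H₂ q.1 q.2⟫_ℂ := by
    rintro ⟨x, v⟩ ⟨y, w⟩
    simp only [inner_kerFun_kerFun, hK, map_smul, inner_smul_left, inner_smul_right,
      smul_apply, Complex.conj_conj]
    ring
  obtain ⟨W, hW⟩ := exists_linearIsometryEquiv_of_gram_eq _ _ hgram
    (fun f hf => eq_zero_of_inner_kerFun f fun x v => by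
      obtain ⟨x, rfl⟩ := he x
      have hcx : conj (c x) ≠ 0 := (map_ne_zero _).mpr (hc x)
      simpa [smul_smul, hcx] using hf (x, (conj (c x))⁻¹ • v))
    (fun f hf => eq_zero_of_inner_kerFun f fun x v => hf (x, v))
  refine ⟨W, fun f x => ext_inner_left ℂ fun v => ?_⟩
  rw [← RKHS.kerFun_inner, ← hW (x, v), W.inner_map_map, RKHS.kerFun_inner, inner_smul_left,
    inner_smul_right, Complex.conj_conj]

theorem adjoint_sub_comp_sub {H : Type*} [NormedAddCommGroup H]
    [InnerProductSpace ℂ H] [CompleteSpace H] (G K : V →L[ℂ] H) :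
    (G - K).adjoint ∘L (G - K)
      = G.adjoint ∘L G - G.adjoint ∘L K - (K.adjoint ∘L G - K.adjoint ∘L K) := by
  have h : (G - K).adjoint = G.adjoint - K.adjoint := map_sub _ _ _
  rw [h, ContinuousLinearMap.sub_comp, ContinuousLinearMap.comp_sub, ContinuousLinearMap.comp_sub]

theorem norm_adjoint_apply_le_sqrt {H : Type*} [NormedAddCommGroup H]
    [InnerProductSpace ℂ H] [CompleteSpace H] (G : V →L[ℂ] H) (f : H) :
    ‖G.adjoint f‖ ≤ √‖G.adjoint ∘L G‖ * ‖f‖ := by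
  rw [ContinuousLinearMap.norm_adjoint_comp_self, Real.sqrt_mul_self (norm_nonneg _),
    ← LinearIsometryEquiv.norm_map ContinuousLinearMap.adjoint G]
  exact ContinuousLinearMap.le_opNorm _ _

/-- The elements of a reproducing kernel Hilbert space with jointly continuous kernel are
continuous, since `‖k_y - k_x‖² = ‖K(y,y) - K(y,x) - (K(x,y) - K(x,x))‖`. -/
theorem continuous_of_continuous_kernel {X H : Type*} [TopologicalSpace X] [NormedAddCommGroup H]
    [InnerProductSpace ℂ H] [CompleteSpace H] [RKHS ℂ H X V]
    (hK : Continuous fun p : X × X => RKHS.kernel H p.1 p.2) (f : H) : Continuous f := by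
  rw [continuous_iff_continuousAt]
  intro x
  set d : X → V →L[ℂ] V := fun y =>
    RKHS.kernel H y y - RKHS.kernel H y x - (RKHS.kernel H x y - RKHS.kernel H x x) with hd
  have hbound : ∀ y, ‖f y - f x‖ ≤ √‖d y‖ * ‖f‖ := by
    intro y
    have h1 : f y - f x = (RKHS.kerFun H y - RKHS.kerFun H x).adjoint f := by
      have h2 : (RKHS.kerFun H y - RKHS.kerFun H x).adjoint
          = (RKHS.kerFun H y).adjoint - (RKHS.kerFun H x).adjoint := map_sub _ _ _
      rw [h2, sub_apply, RKHS.adjoint_kerFun, RKHS.adjoint_kerFun]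
    have h3 : d y = (RKHS.kerFun H y - RKHS.kerFun H x).adjoint ∘L
        (RKHS.kerFun H y - RKHS.kerFun H x) := by
      refine Eq.trans ?_ (adjoint_sub_comp_sub (RKHS.kerFun H y) (RKHS.kerFun H x)).symm
      simp only [hd, RKHS.kernel_apply]
    rw [h1, h3]
    exact norm_adjoint_apply_le_sqrt _ _
  have hc : Continuous d := by
    have c : ∀ g : X → X × X, Continuous g →
        Continuous fun y => RKHS.kernel H (g y).1 (g y).2 := fun g hg =>
      Continuous.comp (g := fun p : X × X => RKHS.kernel H p.1 p.2) hK hg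
    have c1 := c (fun y => (y, y)) (by fun_prop)
    have c2 := c (fun y => (y, x)) (by fun_prop)
    have c3 := c (fun y => (x, y)) (by fun_prop)
    exact (c1.sub c2).sub (c3.sub continuous_const)
  have hlim : Filter.Tendsto (fun y => √‖d y‖ * ‖f‖) (nhds x) (nhds 0) := by
    have h0 : √‖d x‖ * ‖f‖ = 0 := by simp [hd]
    rw [← h0]
    exact ((Real.continuous_sqrt.comp hc.norm).mul continuous_const).tendsto x
  exact tendsto_iff_norm_sub_tendsto_zero.mpr
    (squeeze_zero (fun _ => norm_nonneg _) hbound hlim)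

end rkhs

/-! ### Contraction semigroups with bounded generators -/

section exponential

open NormedSpace Filter

variable {X : Type*} [NormedAddCommGroup X] [InnerProductSpace ℂ X] [CompleteSpace X]

theorem hasDerivAt_exp_smul_apply (B : X →L[ℂ] X) (x : X) (t : ℝ) :
    HasDerivAt (fun s : ℝ => exp (s • B) x) (exp (t • B) (B x)) t := by
  have h := hasDerivAt_exp_smul_const (𝕂 := ℝ) B t
  have h2 := ((ContinuousLinearMap.apply ℂ X x).restrictScalars ℝ).hasFDerivAt.comp_hasDerivAt t h
  exact h2

/-- Commuting bounded generators of contraction semigroups satisfy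
`‖exp(tB)x - exp(tC)x‖ ≤ t ‖Bx - Cx‖`: differentiate `s ↦ exp(sB) exp((t-s)C) x` on `[0, t]`. -/
theorem norm_exp_sub_exp_le {B C : X →L[ℂ] X} (hBC : Commute B C)
    (hB : ∀ t : ℝ, 0 ≤ t → ‖exp (t • B)‖ ≤ 1) (hC : ∀ t : ℝ, 0 ≤ t → ‖exp (t • C)‖ ≤ 1)
    (x : X) {t : ℝ} (ht : 0 ≤ t) :
    ‖exp (t • B) x - exp (t • C) x‖ ≤ t * ‖B x - C x‖ := by
  have hcomm : ∀ s r : ℝ, exp (s • (B - C)) * exp (r • C) = exp (s • B) * exp ((r - s) • C) := by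
    intro s r
    have h1 : Commute (s • (B - C)) (r • C) :=
      ((hBC.sub_left (Commute.refl C)).smul_left s).smul_right r
    have h2 : Commute (s • B) ((r - s) • C) := (hBC.smul_left s).smul_right (r - s)
    let _ : NormedAlgebra ℚ (X →L[ℂ] X) := NormedAlgebra.restrictScalars ℚ ℝ _
    rw [← exp_add_of_commute h1, ← exp_add_of_commute h2]
    congr 1
    module
  have hC1 : ∀ r : ℝ, ∀ y, (B - C) (exp (r • C) y) = exp (r • C) ((B - C) y) := by
    intro r y
    have h1 : Commute (B - C) (exp (r • C)) :=
      ((hBC.sub_left (Commute.refl C)).smul_right r).exp_right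
    exact congrArg (fun G : X →L[ℂ] X => G y) h1.eq
  have hmv := norm_image_sub_le_of_norm_deriv_le_segment' (a := 0) (b := t)
    (f := fun s : ℝ => exp (s • (B - C)) (exp (t • C) x))
    (f' := fun s : ℝ => exp (s • (B - C)) ((B - C) (exp (t • C) x)))
    (C := ‖B x - C x‖)
    (fun s _ => (hasDerivAt_exp_smul_apply (B - C) _ s).hasDerivWithinAt) ?_ t ⟨ht, le_rfl⟩
  · have e0 : exp ((0 : ℝ) • (B - C)) (exp (t • C) x) = exp (t • C) x := by simp
    have e1 : exp (t • (B - C)) (exp (t • C) x) = exp (t • B) x := by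
      have := congrArg (fun G : X →L[ℂ] X => G x) (hcomm t t)
      simpa using this
    simp only [e0, e1, sub_zero] at hmv
    linarith
  · intro s hs
    have h1 : exp (s • (B - C)) ((B - C) (exp (t • C) x))
        = exp (s • B) (exp ((t - s) • C) ((B - C) x)) := by
      rw [hC1]
      exact congrArg (fun G : X →L[ℂ] X => G ((B - C) x)) (hcomm s t)
    rw [h1]
    calc _ ≤ 1 * ‖exp ((t - s) • C) ((B - C) x)‖ :=
          ContinuousLinearMap.le_of_opNorm_le _ (hB s hs.1) _
      _ ≤ 1 * (1 * ‖(B - C) x‖) := by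
          gcongr
          exact ContinuousLinearMap.le_of_opNorm_le _ (hC _ (by linarith [hs.2])) _
      _ = _ := by simp

theorem norm_exp_sub_self_le {B : X →L[ℂ] X} (hB : ∀ t : ℝ, 0 ≤ t → ‖exp (t • B)‖ ≤ 1)
    (x : X) {t : ℝ} (ht : 0 ≤ t) : ‖exp (t • B) x - x‖ ≤ t * ‖B x‖ := by
  have h := norm_exp_sub_exp_le (C := 0) (Commute.zero_right B) hB
    (fun t _ => by
      rw [smul_zero, exp_zero]
      exact ContinuousLinearMap.norm_id_le) x ht
  simpa using h

/-- First-order Taylor estimate for `exp (t B) x`, by the mean value inequality for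
`s ↦ exp (s B) x - s B x`. -/
theorem norm_exp_sub_taylor_le (B : X →L[ℂ] X) (x : X) {t c : ℝ} (ht : 0 ≤ t)
    (hc : ∀ s ∈ Set.Ico 0 t, ‖exp (s • B) (B x) - B x‖ ≤ c) :
    ‖exp (t • B) x - x - t • B x‖ ≤ c * t := by
  have hmv := norm_image_sub_le_of_norm_deriv_le_segment' (a := 0) (b := t)
    (f := fun s : ℝ => exp (s • B) x - s • B x)
    (f' := fun s : ℝ => exp (s • B) (B x) - B x) (C := c)
    (fun s _ => ((hasDerivAt_exp_smul_apply B x s).sub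
      (by simpa using (hasDerivAt_id s).smul_const (B x))).hasDerivWithinAt) hc t ⟨ht, le_rfl⟩
  simp only [zero_smul, exp_zero, one_apply_eq_self, sub_zero] at hmv
  rwa [sub_right_comm]

end exponential

/-! ### Strong limits of contraction semigroups -/

section generation

open NormedSpace Filter Topology

variable {X : Type*} [NormedAddCommGroup X] [InnerProductSpace ℂ X] [CompleteSpace X]

/-- Uniformly bounded operators that are strongly Cauchy on a dense set converge strongly. -/
theorem exists_tendsto_of_dense {G : ℕ → X →L[ℂ] X} (hG : ∀ n, ‖G n‖ ≤ 1) {D : Set X}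
    (hD : Dense D) (h : ∀ x ∈ D, CauchySeq fun n => G n x) (x : X) :
    ∃ y, Tendsto (fun n => G n x) atTop (𝓝 y) := by
  refine cauchySeq_tendsto_of_complete ?_
  rw [Metric.cauchySeq_iff]
  intro ε hε
  obtain ⟨y, hxy, hy⟩ := Metric.dense_iff.mp hD x (ε / 3) (by positivity)
  obtain ⟨N, hN⟩ := Metric.cauchySeq_iff.mp (h y hy) (ε / 3) (by positivity)
  have hxy' : dist x y < ε / 3 := by rw [dist_comm]; exact hxy
  have hd : ∀ n, dist (G n x) (G n y) ≤ dist x y := fun n => by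
    rw [dist_eq_norm, dist_eq_norm, ← map_sub]
    simpa using ContinuousLinearMap.le_of_opNorm_le _ (hG n) (x - y)
  refine ⟨N, fun m hm n hn => ?_⟩
  have h1 := dist_triangle4 (G m x) (G m y) (G n y) (G n x)
  have h2 := hN m hm n hn
  have h3 := hd m
  have h4 := hd n
  rw [dist_comm] at h4
  linarith

theorem exists_clm_of_tendsto {G : ℕ → X →L[ℂ] X}
    (h : ∀ x, ∃ y, Tendsto (fun n => G n x) atTop (𝓝 y)) :
    ∃ T : X →L[ℂ] X, ∀ x, Tendsto (fun n => G n x) atTop (𝓝 (T x)) := by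
  choose f hf using h
  exact ⟨continuousLinearMapOfTendsto G (tendsto_pi_nhds.mpr hf), hf⟩

/-- If the bounded operators `B n` commute, generate contraction semigroups and converge strongly
to `A` on its dense domain, then the semigroups `exp (t B n)` converge strongly to a strongly
continuous contraction semigroup whose generator extends `A`. -/
theorem exists_contractionSemigroup {B : ℕ → X →L[ℂ] X} (hcomm : ∀ n m, Commute (B n) (B m))
    (hB : ∀ n, ∀ t : ℝ, 0 ≤ t → ‖exp (t • B n)‖ ≤ 1) {A : X →ₗ.[ℂ] X}
    (hD : Dense (A.domain : Set X))
    (hA : ∀ x : A.domain, Tendsto (fun n => B n x) atTop (𝓝 (A x))) :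
    ∃ T : ℝ → X →L[ℂ] X, T 0 = 1 ∧
      (∀ s t : ℝ, 0 ≤ s → 0 ≤ t → T (s + t) = T s ∘L T t) ∧
      (∀ t : ℝ, 0 ≤ t → ∀ x, ‖T t x‖ ≤ ‖x‖) ∧
      (∀ x : X, Tendsto (fun t : ℝ => T t x) (𝓝[>] 0) (𝓝 x)) ∧
      ∀ x : A.domain, Tendsto (fun t : ℝ => ((t⁻¹ : ℝ) : ℂ) • (T t x - x)) (𝓝[>] 0)
        (𝓝 (A x)) := by
  have hBle : ∀ n, ∀ t : ℝ, 0 ≤ t → ∀ x, ‖exp (t • B n) x‖ ≤ ‖x‖ := fun n t ht x => by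
    simpa using ContinuousLinearMap.le_of_opNorm_le _ (hB n t ht) x
  have hcauchy : ∀ t : ℝ, 0 ≤ t → ∀ x ∈ (A.domain : Set X),
      CauchySeq fun n => exp (t • B n) x := by
    intro t ht x hx
    rw [Metric.cauchySeq_iff]
    intro ε hε
    obtain ⟨N, hN⟩ := Metric.cauchySeq_iff.mp (hA ⟨x, hx⟩).cauchySeq (ε / (t + 1)) (by positivity)
    refine ⟨N, fun m hm n hn => ?_⟩
    have h1 := norm_exp_sub_exp_le (hcomm m n) (hB m) (hB n) x ht
    have h2 := hN m hm n hn
    rw [dist_eq_norm, lt_div_iff₀ (by positivity)] at h2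
    rw [dist_eq_norm]
    nlinarith [norm_nonneg (B m x - B n x)]
  have hex : ∀ t : ℝ, ∃ S : X →L[ℂ] X, 0 ≤ t →
      ∀ x, Tendsto (fun n => exp (t • B n) x) atTop (𝓝 (S x)) := by
    intro t
    by_cases ht : 0 ≤ t
    · obtain ⟨S, hS⟩ := exists_clm_of_tendsto
        (exists_tendsto_of_dense (fun n => hB n t ht) hD (hcauchy t ht))
      exact ⟨S, fun _ => hS⟩
    · exact ⟨0, fun h => absurd h ht⟩
  choose T hT using hex
  have hTle : ∀ t : ℝ, 0 ≤ t → ∀ x, ‖T t x‖ ≤ ‖x‖ := fun t ht x =>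
    le_of_tendsto (hT t ht x).norm (Eventually.of_forall fun n => hBle n t ht x)
  have hTdom : ∀ t : ℝ, 0 ≤ t → ∀ x : A.domain, ‖T t x - x‖ ≤ t * ‖A x‖ := fun t ht x =>
    le_of_tendsto_of_tendsto ((hT t ht x).sub_const _).norm ((hA x).norm.const_mul t)
      (Eventually.of_forall fun n => norm_exp_sub_self_le (hB n) x ht)
  -- On all of `X` the bound on the domain holds up to twice the distance to the domain.
  have happrox : ∀ {G : X →L[ℂ] X}, (∀ x, ‖G x‖ ≤ ‖x‖) → ∀ x y : X,
      ‖G x - x‖ ≤ 2 * ‖x - y‖ + ‖G y - y‖ := by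
    intro G hG x y
    have h1 : G x - x = G (x - y) - (x - y) + (G y - y) := by
      rw [map_sub]; abel
    rw [h1]
    refine (norm_add_le _ _).trans ?_
    have := norm_sub_le (G (x - y)) (x - y)
    linarith [hG (x - y)]
  have hdense : ∀ x : X, ∀ ε > 0, ∃ y : A.domain, ‖x - y‖ < ε := by
    intro x ε hε
    obtain ⟨y, hxy, hy⟩ := Metric.dense_iff.mp hD x ε hε
    refine ⟨⟨y, hy⟩, ?_⟩
    rwa [Metric.mem_ball, dist_comm, dist_eq_norm] at hxy
  have hpos : ∀ᶠ t : ℝ in 𝓝[>] 0, 0 < t := self_mem_nhdsWithin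
  have hsmall : ∀ (c ε : ℝ), 0 < ε → ∀ᶠ t : ℝ in 𝓝[>] 0, t * c < ε := by
    intro c ε hε
    have h0 : Tendsto (fun t : ℝ => t * c) (𝓝[>] 0) (𝓝 0) := by
      have : Tendsto (fun t : ℝ => t * c) (𝓝 0) (𝓝 (0 * c)) := tendsto_id.mul_const c
      rw [zero_mul] at this
      exact this.mono_left nhdsWithin_le_nhds
    exact h0.eventually (gt_mem_nhds hε)
  refine ⟨T, ?_, ?_, hTle, ?_, ?_⟩
  · ext x
    refine tendsto_nhds_unique (hT 0 le_rfl x) ?_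
    simp
  · intro s t hs ht
    ext x
    refine tendsto_nhds_unique (hT (s + t) (add_nonneg hs ht) x) ?_
    have h1 : ∀ n, exp ((s + t) • B n) x = exp (s • B n) (exp (t • B n) x) := fun n => by
      let _ : NormedAlgebra ℚ (X →L[ℂ] X) := NormedAlgebra.restrictScalars ℚ ℝ _
      rw [add_smul, exp_add_of_commute (((Commute.refl (B n)).smul_left s).smul_right t)]
      rfl
    simp only [h1]
    have h2 : Tendsto (fun n => exp (s • B n) (exp (t • B n) x - T t x)) atTop (𝓝 0) := by
      refine squeeze_zero_norm (fun n => hBle n s hs _) ?_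
      exact tendsto_iff_norm_sub_tendsto_zero.mp (hT t ht x)
    have h3 := h2.add (hT s hs (T t x))
    simpa using h3
  · intro x
    rw [Metric.tendsto_nhds]
    intro ε hε
    obtain ⟨y, hy⟩ := hdense x (ε / 4) (by positivity)
    filter_upwards [hpos, hsmall ‖A y‖ (ε / 2) (by positivity)] with t ht0 ht
    rw [dist_eq_norm]
    have h1 := happrox (hTle t ht0.le) x y
    have h2 := hTdom t ht0.le y
    linarith
  · intro x
    rw [Metric.tendsto_nhds]
    intro ε hε
    obtain ⟨y, hy⟩ := hdense (A x) (ε / 4) (by positivity)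
    filter_upwards [hpos, hsmall ‖A y‖ (ε / 2) (by positivity)] with t ht0 ht
    have key : ‖T t x - x - t • A x‖ ≤ (2 * ‖A x - y‖ + t * ‖A y‖) * t := by
      have hlim : Tendsto (fun n => (2 * ‖B n x - y‖ + t * ‖B n y‖) * t) atTop
          (𝓝 ((2 * ‖A x - y‖ + t * ‖A y‖) * t)) :=
        ((((hA x).sub_const _).norm.const_mul 2).add ((hA y).norm.const_mul t)).mul_const t
      refine le_of_tendsto_of_tendsto
        (((hT t ht0.le x).sub_const _).sub ((hA x).const_smul t)).norm hlim
        (Eventually.of_forall fun n => ?_)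
      refine norm_exp_sub_taylor_le (B n) x ht0.le fun s hs => ?_
      refine (happrox (hBle n s hs.1) (B n x) y).trans ?_
      gcongr
      refine (norm_exp_sub_self_le (hB n) (y : X) hs.1).trans ?_
      gcongr
      exact hs.2.le
    have h1 : ((t⁻¹ : ℝ) : ℂ) • (T t x - x) - A x = (t⁻¹ : ℝ) • (T t x - x - t • A x) := by
      rw [Complex.coe_smul, smul_sub t⁻¹ _ (t • A x), smul_smul, inv_mul_cancel₀ ht0.ne',
        one_smul]
    rw [dist_eq_norm, h1, norm_smul, norm_inv, Real.norm_eq_abs, abs_of_pos ht0]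
    rw [inv_mul_lt_iff₀ ht0]
    nlinarith

end generation

/-! ### Resolvents of dissipative operators -/

section resolvent

variable {X : Type*} [NormedAddCommGroup X] [InnerProductSpace ℂ X] {A : X →ₗ.[ℂ] X} {μ ν : ℂ}

theorem apply_linInv {E F : Type*} [AddCommGroup E] [Module ℂ E] [AddCommGroup F] [Module ℂ F]
    {f : E →ₗ[ℂ] F} (hf : Function.Bijective f) (y : F) : f (linInv f y) = y := by
  rw [linInv, dif_pos hf]
  exact (LinearEquiv.ofBijective f hf).apply_symm_apply y

theorem linInv_eq_iff {E F : Type*} [AddCommGroup E] [Module ℂ E] [AddCommGroup F] [Module ℂ F]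
    {f : E →ₗ[ℂ] F} (hf : Function.Bijective f) {x : E} {y : F} : linInv f y = x ↔ f x = y := by
  rw [← hf.1.eq_iff, apply_linInv hf, eq_comm]

theorem shift_apply (x : A.domain) : shift A μ x = μ • (x : X) - A x := rfl

theorem resolventMap_eq_iff (hμ : μ ∈ resSet A) {x : A.domain} {y : X} :
    resolventMap A μ y = x ↔ μ • (x : X) - A x = y :=
  linInv_eq_iff hμ

theorem apply_resolventMap (hμ : μ ∈ resSet A) (y : X) :
    A (resolventMap A μ y) = μ • (resolventMap A μ y : X) - y := by
  have h := (resolventMap_eq_iff hμ).mp (rfl : resolventMap A μ y = _)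
  rw [sub_eq_iff_eq_add] at h
  rw [h, add_sub_cancel_left]

theorem resolventMap_shift (hμ : μ ∈ resSet A) (x : A.domain) :
    resolventMap A μ (μ • (x : X) - A x) = x :=
  (resolventMap_eq_iff hμ).mpr rfl

/-- The resolvent identity. -/
theorem resolventMap_sub (hμ : μ ∈ resSet A) (hν : ν ∈ resSet A) (x : X) :
    resolventMap A μ x - resolventMap A ν x
      = (ν - μ) • resolventMap A μ (resolventMap A ν x : X) := by
  rw [← map_smul, eq_comm, resolventMap_eq_iff hμ, LinearPMap.map_sub, apply_resolventMap hμ,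
    apply_resolventMap hν, Submodule.coe_sub]
  module

theorem resolventMap_comm (hμ : μ ∈ resSet A) (hν : ν ∈ resSet A) (x : X) :
    resolventMap A μ (resolventMap A ν x : X) = resolventMap A ν (resolventMap A μ x : X) := by
  rcases eq_or_ne μ ν with rfl | hne
  · rfl
  · have h1 := resolventMap_sub hμ hν x
    have h2 := resolventMap_sub hν hμ x
    rw [← neg_sub, h1, ← neg_smul, neg_sub] at h2
    exact smul_right_injective _ (sub_ne_zero.mpr hne) h2

/-- For a dissipative operator `‖(μ - A) x‖ ≥ Re μ ‖x‖`. -/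
theorem re_mul_norm_le_of_dissipative (hdiss : ∀ x : A.domain, (⟪A x, (x : X)⟫_ℂ).re ≤ 0)
    (x : A.domain) : μ.re * ‖(x : X)‖ ≤ ‖μ • (x : X) - A x‖ := by
  have h1 : (⟪μ • (x : X) - A x, (x : X)⟫_ℂ).re ≤ ‖μ • (x : X) - A x‖ * ‖(x : X)‖ :=
    (Complex.re_le_norm _).trans (norm_inner_le_norm _ _)
  have h2 : (⟪μ • (x : X) - A x, (x : X)⟫_ℂ).re
      = μ.re * ‖(x : X)‖ ^ 2 - (⟪A x, (x : X)⟫_ℂ).re := by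
    rw [inner_sub_left, inner_smul_left, inner_self_eq_norm_sq_to_K]
    simp [← Complex.ofReal_pow]
  have h3 := hdiss x
  rcases (norm_nonneg (x : X)).eq_or_lt with h0 | h0
  · rw [← h0]; simp
  · refine le_of_mul_le_mul_right ?_ h0
    nlinarith

/-- The domain of a maximally dissipative operator is dense: if `v = μ x - A x` is orthogonal to the
domain, then `0 = Re ⟪v, x⟫ ≥ Re μ ‖x‖²`. -/
theorem dense_domain_of_dissipative [CompleteSpace X]
    (hdiss : ∀ x : A.domain, (⟪A x, (x : X)⟫_ℂ).re ≤ 0)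
    (hμ : μ ∈ resSet A) (hμ0 : 0 < μ.re) : Dense (A.domain : Set X) := by
  rw [Submodule.dense_iff_topologicalClosure_eq_top, Submodule.topologicalClosure_eq_top_iff,
    Submodule.eq_bot_iff]
  intro v hv
  obtain ⟨x, hx⟩ := hμ.2 v
  rw [shift_apply] at hx
  have h0 : ⟪v, (x : X)⟫_ℂ = 0 := (Submodule.mem_orthogonal' _ _).mp hv _ x.2
  have h2 : (⟪v, (x : X)⟫_ℂ).re = μ.re * ‖(x : X)‖ ^ 2 - (⟪A x, (x : X)⟫_ℂ).re := by
    rw [← hx, inner_sub_left, inner_smul_left, inner_self_eq_norm_sq_to_K]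
    simp [← Complex.ofReal_pow]
  rw [h0, Complex.zero_re] at h2
  have h3 := hdiss x
  have h4 : ‖(x : X)‖ ^ 2 = 0 := by
    have : 0 ≤ ‖(x : X)‖ ^ 2 := by positivity
    nlinarith
  have hx0 : x = 0 := by simpa using h4
  rw [← hx, hx0]
  simp

end resolvent

/-! ### The Lumer–Phillips theorem -/

section generation

open NormedSpace Filter Topology

variable {X : Type*} [NormedAddCommGroup X] [InnerProductSpace ℂ X] [CompleteSpace X]

/-- Bounded dissipative operators generate contraction semigroups. -/
theorem norm_exp_smul_le_one_of_dissipative {B : X →L[ℂ] X} (hB : ∀ x, (⟪B x, x⟫_ℂ).re ≤ 0)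
    {t : ℝ} (ht : 0 ≤ t) : ‖exp (t • B)‖ ≤ 1 := by
  refine ContinuousLinearMap.opNorm_le_bound _ zero_le_one fun x => ?_
  have hd : ∀ s : ℝ, HasDerivAt (fun s : ℝ => ‖exp (s • B) x‖ ^ 2)
      (2 * (⟪exp (s • B) x, B (exp (s • B) x)⟫_ℂ).re) s := by
    intro s
    let _ : InnerProductSpace ℝ X := InnerProductSpace.complexToReal
    have h1 := HasDerivAt.norm_sq (F := X) (hasDerivAt_exp_smul_apply B x s)
    have h2 : exp (s • B) (B x) = B (exp (s • B) x) := by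
      have : Commute (exp (s • B)) B := (((Commute.refl B).smul_right s).exp_right).symm
      exact congrArg (fun G : X →L[ℂ] X => G x) this.eq
    rw [h2] at h1
    exact h1
  have hanti : Antitone fun s : ℝ => ‖exp (s • B) x‖ ^ 2 := by
    refine antitone_of_deriv_nonpos (fun s => (hd s).differentiableAt) fun s => ?_
    rw [(hd s).deriv, ← inner_conj_symm, Complex.conj_re]
    linarith [hB (exp (s • B) x)]
  have h := hanti ht
  simp only [zero_smul, exp_zero, one_apply_eq_self] at h
  rw [one_mul]
  exact (sq_le_sq₀ (norm_nonneg _) (norm_nonneg _)).mp h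

/-- The **Lumer–Phillips theorem**: a dissipative operator on a Hilbert space whose resolvent set
contains the positive half-axis generates a strongly continuous semigroup (of contractions). -/
theorem isC0Generator_of_dissipative {A : X →ₗ.[ℂ] X}
    (hdiss : ∀ x : A.domain, (⟪A x, (x : X)⟫_ℂ).re ≤ 0)
    (hres : ∀ r : ℝ, 0 < r → (r : ℂ) ∈ resSet A) : IsC0Generator A := by
  have hD : Dense (A.domain : Set X) :=
    dense_domain_of_dissipative hdiss (hres 1 one_pos) (by simp)
  set l : ℕ → ℝ := fun n => n + 1 with hl
  have hl0 : ∀ n, 0 < l n := fun n => by positivity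
  have hlr : ∀ n, (l n : ℂ) ∈ resSet A := fun n => hres _ (hl0 n)
  have hlne : ∀ n, (l n : ℂ) ≠ 0 := fun n => by exact_mod_cast (hl0 n).ne'
  have hRle : ∀ n x, ‖(resolventMap A (l n) x : X)‖ ≤ (l n)⁻¹ * ‖x‖ := fun n x => by
    have h1 := re_mul_norm_le_of_dissipative (μ := l n) hdiss (resolventMap A (l n) x)
    rw [apply_resolventMap (hlr n), sub_sub_cancel, Complex.ofReal_re] at h1
    rwa [← div_eq_inv_mul, le_div_iff₀' (hl0 n)]
  set R : ℕ → X →L[ℂ] X := fun n =>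
    (A.domain.subtype ∘ₗ (resolventMap A (l n) : X →ₗ[ℂ] A.domain)).mkContinuous _ (hRle n)
    with hR
  have hRapply : ∀ n x, R n x = (resolventMap A (l n) x : X) := fun n x => rfl
  -- The Yosida approximations `l A (l - A)⁻¹ = l² (l - A)⁻¹ - l`.
  set B : ℕ → X →L[ℂ] X := fun n => (l n : ℂ) • ((l n : ℂ) • R n - 1) with hB
  have hBA : ∀ n x, B n x = (l n : ℂ) • A (resolventMap A (l n) x) := fun n x => by
    rw [apply_resolventMap (hlr n)]; rfl
  have hcommR : ∀ n m, Commute (R n) (R m) := fun n m => by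
    ext x
    exact congrArg Subtype.val (resolventMap_comm (hlr n) (hlr m) x)
  have hcomm : ∀ n m, Commute (B n) (B m) := fun n m =>
    (((((hcommR n m).smul_left _).smul_right _).sub_left (Commute.one_left _)).sub_right
      (Commute.one_right _)).smul_left _ |>.smul_right _
  have hBdiss : ∀ n x, (⟪B n x, x⟫_ℂ).re ≤ 0 := fun n x => by
    set y := resolventMap A (l n) x with hy
    have h1 : x = (l n : ℂ) • (y : X) - A y := by
      rw [hy, apply_resolventMap (hlr n), sub_sub_cancel]
    have h2 : B n x = (l n : ℂ) • A y := hBA n x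
    have h3 : (⟪B n x, x⟫_ℂ).re = l n ^ 2 * (⟪A y, (y : X)⟫_ℂ).re - l n * ‖A y‖ ^ 2 := by
      rw [h2, h1, inner_smul_left, inner_sub_right, inner_smul_right, inner_self_eq_norm_sq_to_K]
      simp [← Complex.ofReal_pow]
      ring
    rw [h3]
    have h4 := mul_nonpos_of_nonneg_of_nonpos (sq_nonneg (l n)) (hdiss y)
    have h5 := mul_nonneg (hl0 n).le (sq_nonneg ‖A y‖)
    linarith
  have hlinv : Tendsto (fun n => (l n)⁻¹) atTop (𝓝 0) :=
    tendsto_inv_atTop_zero.comp (tendsto_atTop_add_const_right _ _ tendsto_natCast_atTop_atTop)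
  -- `l (l - A)⁻¹ → 1` strongly, first on the domain and then everywhere.
  have hlRdom : ∀ x : A.domain, Tendsto (fun n => (l n : ℂ) • R n x) atTop (𝓝 (x : X)) := by
    intro x
    rw [tendsto_iff_norm_sub_tendsto_zero]
    refine squeeze_zero (fun _ => norm_nonneg _) (g := fun n => (l n)⁻¹ * ‖A x‖) (fun n => ?_) ?_
    · have h1 := congrArg (Subtype.val) (resolventMap_shift (hlr n) x)
      rw [map_sub, map_smul, Submodule.coe_sub, Submodule.coe_smul, sub_eq_iff_eq_add] at h1
      rw [hRapply, h1, add_sub_cancel_left]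
      exact hRle n _
    · simpa using hlinv.mul_const ‖A x‖
  have hlR : ∀ x : X, Tendsto (fun n => (l n : ℂ) • R n x) atTop (𝓝 x) := by
    have hle : ∀ n x, ‖(l n : ℂ) • R n x‖ ≤ ‖x‖ := fun n x => by
      rw [norm_smul, Complex.norm_real, Real.norm_eq_abs, abs_of_pos (hl0 n)]
      calc _ ≤ l n * ((l n)⁻¹ * ‖x‖) := by
            gcongr
            exact hRle n x
        _ = ‖x‖ := by rw [mul_inv_cancel_left₀ (hl0 n).ne']
    intro x
    rw [Metric.tendsto_nhds]
    intro ε hε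
    obtain ⟨y, hxy, hy⟩ := Metric.dense_iff.mp hD x (ε / 3) (by positivity)
    rw [Metric.mem_ball, dist_comm, dist_eq_norm] at hxy
    filter_upwards [Metric.tendsto_nhds.mp (hlRdom ⟨y, hy⟩) (ε / 3) (by positivity)] with n hn
    rw [dist_eq_norm] at hn ⊢
    have h1 : (l n : ℂ) • R n x - x
        = (l n : ℂ) • R n (x - y) + ((l n : ℂ) • R n y - y) - (x - y) := by
      rw [map_sub, smul_sub]; abel
    rw [h1]
    have h2 := norm_sub_le ((l n : ℂ) • R n (x - y) + ((l n : ℂ) • R n y - y)) (x - y)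
    have h3 := norm_add_le ((l n : ℂ) • R n (x - y)) ((l n : ℂ) • R n y - y)
    have h4 := hle n (x - y)
    linarith
  have hBlim : ∀ x : A.domain, Tendsto (fun n => B n x) atTop (𝓝 (A x)) := by
    intro x
    refine (hlR (A x)).congr fun n => ?_
    rw [hBA, apply_resolventMap (hlr n), hRapply]
    congr 1
    have h1 := congrArg (Subtype.val) (resolventMap_shift (hlr n) x)
    rw [map_sub, map_smul, Submodule.coe_sub, Submodule.coe_smul, sub_eq_iff_eq_add] at h1
    rw [h1, add_sub_cancel_left]
  obtain ⟨T, hT0, hTadd, hTle, hTcont, hTA⟩ := exists_contractionSemigroup hcomm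
    (fun n t ht => norm_exp_smul_le_one_of_dissipative (hBdiss n) ht) hD hBlim
  refine ⟨T, hT0, hTadd, hTcont, fun x z => ⟨fun h => ?_, fun h => ?_⟩⟩
  · obtain ⟨y, rfl, rfl⟩ := (LinearPMap.mem_graph_iff A).mp h
    exact hTA y
  · -- `1 - A` is onto and `1 - G` is injective for the generator `G ⊇ A` of a contraction semigroup.
    obtain ⟨y, hy⟩ := (hres 1 one_pos).2 (x - z)
    rw [shift_apply, Complex.ofReal_one, one_smul] at hy
    have hw : Tendsto (fun t : ℝ => ((t⁻¹ : ℝ) : ℂ) • (T t (x - y) - (x - y))) (𝓝[>] 0)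
        (𝓝 (x - y)) := by
      have h1 := h.sub (hTA y)
      have h2 : z - A y = x - y := by
        rw [sub_eq_sub_iff_add_eq_add] at hy ⊢
        rw [add_comm z, hy]
      rw [h2] at h1
      refine h1.congr fun t => ?_
      rw [map_sub]
      module
    have hzero : ‖x - y‖ ≤ 0 := by
      have h1 := (hw.sub_const (x - y)).norm
      rw [sub_self, norm_zero] at h1
      refine ge_of_tendsto h1 ?_
      filter_upwards [self_mem_nhdsWithin] with t (ht : 0 < t)
      have h2 : ‖T t (x - y)‖ ≤ ‖x - y‖ := hTle t ht.le _
      have h3 : (1 + t) • (x - y) = T t (x - y)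
          - t • (((t⁻¹ : ℝ) : ℂ) • (T t (x - y) - (x - y)) - (x - y)) := by
        rw [Complex.coe_smul, smul_sub t, smul_smul, mul_inv_cancel₀ ht.ne']
        module
      have h4 := norm_sub_le (T t (x - y))
        (t • (((t⁻¹ : ℝ) : ℂ) • (T t (x - y) - (x - y)) - (x - y)))
      rw [← h3, norm_smul, norm_smul, Real.norm_eq_abs, Real.norm_eq_abs, abs_of_pos ht,
        abs_of_pos (by linarith)] at h4
      nlinarith
    have hxy : x = y := sub_eq_zero.mp (norm_le_zero_iff.mp hzero)
    rw [LinearPMap.mem_graph_iff]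
    refine ⟨y, hxy.symm, ?_⟩
    rw [hxy] at hy
    exact sub_right_injective hy

end generation

/-! ### The extrapolation space and system nodes -/

section extrapolation

variable {X : Type*} [NormedAddCommGroup X] [InnerProductSpace ℂ X] {A : X →ₗ.[ℂ] X}
  {α β : ℂ}

theorem resolventMap_bijective (hβ : β ∈ resSet A) : Function.Bijective (resolventMap A β) := by
  have hβ' : Function.Bijective (shift A β) := hβ
  rw [resolventMap, linInv, dif_pos hβ']
  exact (LinearEquiv.ofBijective _ hβ).symm.bijective

/-- If one resolvent is bounded then all resolvents are, by the closed graph theorem. -/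
theorem exists_clm_eq_resolventMap [CompleteSpace X] (hα : α ∈ resSet A) {Rα : X →L[ℂ] X}
    (hRα : ∀ x, Rα x = resolventMap A α x) (hβ : β ∈ resSet A) :
    ∃ R : X →L[ℂ] X, ∀ x, R x = resolventMap A β x := by
  set g : X →ₗ[ℂ] X := A.domain.subtype ∘ₗ resolventMap A β with hg
  have hgraph : ∀ p : X × X, p ∈ g.graph ↔ p.2 = Rα ((α - β) • p.2 + p.1) := by
    rintro ⟨x, ξ⟩
    rw [LinearMap.mem_graph_iff]
    constructor
    · intro hξ
      obtain rfl : ξ = (resolventMap A β x : X) := hξ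
      have h := congrArg Subtype.val (resolventMap_shift hα (resolventMap A β x))
      rw [apply_resolventMap hβ] at h
      rw [hRα]
      refine h.symm.trans ?_
      congr 2
      module
    · intro h
      simp only at h ⊢
      rw [hRα] at h
      set y := resolventMap A α ((α - β) • ξ + x) with hy
      have h1 := apply_resolventMap hα ((α - β) • ξ + x)
      rw [← hy, ← h] at h1
      have h2 : resolventMap A β x = y := by
        rw [resolventMap_eq_iff hβ, h1, ← h]
        module
      rw [h, hg, LinearMap.comp_apply, h2]
      rfl
  have hcl : IsClosed (g.graph : Set (X × X)) := by
    have : (g.graph : Set (X × X)) =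
        {p | p.2 = Rα ((α - β) • p.2 + p.1)} := Set.ext hgraph
    rw [this]
    exact isClosed_eq (by fun_prop) (by fun_prop)
  exact ⟨ContinuousLinearMap.ofIsClosedGraph hcl, fun x => rfl⟩

/-- The resolvent `(β - A)⁻¹` extends to a unitary operator from the extrapolation space `X₋₁` onto
`X`. -/
theorem exists_extrapolation_equiv [CompleteSpace X] (hD : Dense (A.domain : Set X))
    (hβ : β ∈ resSet A) :
    ∃ J : Extrapolation A β ≃ₗᵢ[ℂ] X, ∀ x, J (toExtrapolation A β x) = resolventMap A β x := by
  have h1 : DenseRange (toExtrapolation A β) :=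
    UniformSpace.Completion.denseRange_coe (α := PreExtrapolation A β)
  have h2 : DenseRange A.domain.subtype := by
    simpa [DenseRange] using hD
  set f : X ≃ₗ[ℂ] A.domain := LinearEquiv.ofBijective _ (resolventMap_bijective hβ) with hf
  have h3 : ∀ x, ‖A.domain.subtype (f x)‖ = ‖toExtrapolation A β x‖ := fun x =>
    (UniformSpace.Completion.norm_coe (E := PreExtrapolation A β) x).symm
  exact ⟨f.extendOfIsometry _ _ h1 h2 h3, fun x => f.extendOfIsometry_eq _ _ h1 h2 h3 x⟩

end extrapolation

section nodes

variable {X U Y : Type*} [NormedAddCommGroup X] [InnerProductSpace ℂ X]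
  [NormedAddCommGroup U] [InnerProductSpace ℂ U] [NormedAddCommGroup Y] [InnerProductSpace ℂ Y]
  {S : X × U →ₗ.[ℂ] X × Y} {α β : ℂ}

theorem mem_graph_mainOp_iff {x z : X} :
    (x, z) ∈ (mainOp S).graph ↔ ∃ y, ((x, (0 : U)), (z, y)) ∈ S.graph := by
  rw [LinearPMap.mem_graph_iff]
  constructor
  · rintro ⟨x, rfl, rfl⟩
    exact ⟨(S ⟨_, x.2⟩).2, S.mem_graph ⟨_, x.2⟩⟩
  · rintro ⟨y, h⟩
    obtain ⟨⟨p, hp⟩, h1, h2⟩ := (LinearPMap.mem_graph_iff S).mp h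
    obtain rfl : p = (x, 0) := h1
    exact ⟨⟨x, hp⟩, rfl, congrArg Prod.fst h2⟩

theorem mem_graph_of_mem_domain_mainOp (x : (mainOp S).domain) :
    (((x : X), (0 : U)), (mainOp S x, observationOp S x)) ∈ S.graph :=
  S.mem_graph ⟨_, x.2⟩

/-- If `G u = (α - A|_X)⁻¹ B u` for all `u`, then `(x, u)` belongs to the domain of the node exactly
when `x - G u` belongs to the domain of the main operator. -/
theorem mem_domain_iff_sub_mem {G : U → X}
    (hG : ∀ u, ∃ y, ((G u, u), (α • G u, y)) ∈ S.graph) (x : X) (u : U) :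
    (x, u) ∈ S.domain ↔ x - G u ∈ (mainOp S).domain := by
  obtain ⟨y, hy⟩ := hG u
  have h := LinearPMap.mem_domain_of_mem_graph hy
  have h1 : x - G u ∈ (mainOp S).domain ↔ (x - G u, (0 : U)) ∈ S.domain := Iff.rfl
  have h2 : (x, u) = (x - G u, 0) + (G u, u) := by simp
  rw [h1, h2]
  exact Submodule.add_mem_iff_left _ h

/-- The first component of a node, in the form `[A&B] (x, u) = A (x - G u) + α G u`. -/
theorem apply_eq_mainOp_add {G : U → X}
    (hG : ∀ u, ∃ y, ((G u, u), (α • G u, y)) ∈ S.graph) {x : X} {u : U}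
    (h : (x, u) ∈ S.domain) :
    (S ⟨(x, u), h⟩).1 = mainOp S ⟨x - G u, (mem_domain_iff_sub_mem hG x u).mp h⟩ + α • G u := by
  obtain ⟨y, hy⟩ := hG u
  have h1 := S.graph.add_mem
    (mem_graph_of_mem_domain_mainOp ⟨x - G u, (mem_domain_iff_sub_mem hG x u).mp h⟩) hy
  have h2 := S.mem_graph ⟨(x, u), h⟩
  simp only [Prod.mk_add_mk, sub_add_cancel, zero_add] at h1
  exact congrArg Prod.fst (LinearPMap.mem_graph_snd_inj S h2 h1 rfl)

/-- The operator `(β - A|_X)⁻¹ [A|_X  B]`, expressed by `R = (β - A)⁻¹` and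
`G = (α - A|_X)⁻¹ B`. -/
noncomputable def resolventNode (R : X →L[ℂ] X) (G : U →L[ℂ] X) (α β : ℂ) : X × U →L[ℂ] X :=
  (β • R - 1) ∘L (ContinuousLinearMap.fst ℂ X U - G ∘L ContinuousLinearMap.snd ℂ X U)
    + α • (R ∘L G ∘L ContinuousLinearMap.snd ℂ X U)

theorem resolventNode_apply (R : X →L[ℂ] X) (G : U →L[ℂ] X) (α β : ℂ) (x : X) (u : U) :
    resolventNode R G α β (x, u) = β • R (x - G u) - (x - G u) + α • R (G u) := rfl

/-- On the domain of the node, `resolventNode` is `(β - A)⁻¹ [A&B]`. -/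
theorem resolventMap_apply_eq_resolventNode {G : U →L[ℂ] X}
    (hG : ∀ u, ∃ y, ((G u, u), (α • G u, y)) ∈ S.graph) (hβ : β ∈ resSet (mainOp S))
    {R : X →L[ℂ] X} (hR : ∀ x, R x = resolventMap (mainOp S) β x) (v : S.domain) :
    (resolventMap (mainOp S) β (S v).1 : X) = resolventNode R G α β v := by
  obtain ⟨⟨x, u⟩, h⟩ := v
  set x' : (mainOp S).domain := ⟨x - G u, (mem_domain_iff_sub_mem hG x u).mp h⟩ with hx'
  have h1 := congrArg Subtype.val (resolventMap_shift hβ x')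
  rw [map_sub, map_smul, Submodule.coe_sub, Submodule.coe_smul] at h1
  rw [apply_eq_mainOp_add hG h, resolventNode_apply, map_add, map_smul, Submodule.coe_add,
    Submodule.coe_smul, hR, hR]
  congr 1
  rw [sub_eq_iff_eq_add'] at h1
  exact eq_sub_of_add_eq h1.symm

/-- On the extrapolation space, `[A|_X  B]` is determined by the node. -/
theorem IsRiggedExtension.apply_eq (hD : Dense ((mainOp S).domain : Set X)) {G : U →L[ℂ] X}
    (hG : ∀ u, ∃ y, ((G u, u), (α • G u, y)) ∈ S.graph) (hβ : β ∈ resSet (mainOp S))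
    {R : X →L[ℂ] X} (hR : ∀ x, R x = resolventMap (mainOp S) β x)
    {J : Extrapolation (mainOp S) β ≃ₗᵢ[ℂ] X}
    (hJ : ∀ x, J (toExtrapolation (mainOp S) β x) = resolventMap (mainOp S) β x)
    {T : X × U →L[ℂ] Extrapolation (mainOp S) β} (hT : IsRiggedExtension S β T) (v : X × U) :
    J (T v) = resolventNode R G α β v := by
  obtain ⟨x, u⟩ := v
  have h1 : ∀ x : X, J (T (x + G u, u)) = resolventNode R G α β (x + G u, u) := by
    intro x
    refine hD.induction (P := fun x => J (T (x + G u, u)) = resolventNode R G α β (x + G u, u))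
      (fun x hx => ?_) (isClosed_eq (by fun_prop) (by fun_prop)) x
    have hmem : (x + G u, u) ∈ S.domain := by
      rw [mem_domain_iff_sub_mem hG, add_sub_cancel_right]
      exact hx
    rw [← resolventMap_apply_eq_resolventNode hG hβ hR ⟨_, hmem⟩, ← hJ, ← hT]
  simpa using h1 (x - G u)

/-- A closed operator whose main operator `A` generates a strongly continuous semigroup is a system
node as soon as `(α - A|_X)⁻¹ B` exists as a bounded operator `G`, that is, `(G u, u)` is mapped to
`α G u` by `[A&B]`. -/
theorem isSystemNode_of_exists [CompleteSpace X] (hcl : S.IsClosed)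
    (hgen : IsC0Generator (mainOp S))
    (hD : Dense ((mainOp S).domain : Set X)) (hα : α ∈ resSet (mainOp S)) {Rα : X →L[ℂ] X}
    (hRα : ∀ x, Rα x = resolventMap (mainOp S) α x) {G : U →L[ℂ] X}
    (hG : ∀ u, ∃ y, ((G u, u), (α • G u, y)) ∈ S.graph) : IsSystemNode S := by
  refine ⟨hcl, hgen, fun β hβ => ?_⟩
  obtain ⟨R, hR⟩ := exists_clm_eq_resolventMap hα hRα hβ
  obtain ⟨J, hJ⟩ := exists_extrapolation_equiv hD hβ
  set T : X × U →L[ℂ] Extrapolation (mainOp S) β :=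
    (J.symm : X →L[ℂ] Extrapolation (mainOp S) β) ∘L resolventNode R G α β with hTdef
  have hJT : ∀ v, J (T v) = resolventNode R G α β v := fun v => J.apply_symm_apply _
  refine ⟨T, fun v => J.injective ?_, ?_⟩
  · rw [hJT, hJ, resolventMap_apply_eq_resolventNode hG hβ hR]
  · rintro ⟨x, u⟩
    have h1 : T (x, u) ∈ LinearMap.range (toExtrapolation (mainOp S) β)
        ↔ resolventNode R G α β (x, u) ∈ (mainOp S).domain := by
      rw [← hJT]
      constructor
      · rintro ⟨w, hw⟩
        rw [← hw, hJ]
        exact Subtype.mem _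
      · intro h
        obtain ⟨w, hw⟩ := (resolventMap_bijective hβ).2 ⟨_, h⟩
        refine ⟨w, J.injective ?_⟩
        rw [hJ, hw]
    rw [h1, mem_domain_iff_sub_mem hG, resolventNode_apply, hR, hR,
      Submodule.add_mem_iff_left _ (Submodule.smul_mem _ _ (Subtype.mem _)),
      Submodule.sub_mem_iff_right _ (Submodule.smul_mem _ _ (Subtype.mem _))]

/-- The operator `(α - A|_X)⁻¹ B` computed in the extrapolation space does not depend on the
parameter `β` that norms this space. -/
theorem extrapolatedResolventB_eq [CompleteSpace X] (hD : Dense ((mainOp S).domain : Set X))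
    (hα : α ∈ resSet (mainOp S)) {Rα : X →L[ℂ] X}
    (hRα : ∀ x, Rα x = resolventMap (mainOp S) α x) {G : U →L[ℂ] X}
    (hG : ∀ u, ∃ y, ((G u, u), (α • G u, y)) ∈ S.graph) (hβ : β ∈ resSet (mainOp S))
    {T : X × U →L[ℂ] Extrapolation (mainOp S) β} (hT : IsRiggedExtension S β T) (u : U) :
    extrapolatedResolventB S β α T u = G u := by
  obtain ⟨R, hR⟩ := exists_clm_eq_resolventMap hα hRα hβ
  obtain ⟨J, hJ⟩ := exists_extrapolation_equiv hD hβ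
  set f := α • toExtrapolation (mainOp S) β - T.toLinearMap ∘ₗ LinearMap.inl ℂ X U with hf
  have hJf : ∀ x, J (f x) = x + (α - β) • R x := fun x => by
    have h1 : f x = α • toExtrapolation (mainOp S) β x - T (x, 0) := rfl
    rw [h1, map_sub, map_smul, hJ, hT.apply_eq hD hG hβ hR hJ, resolventNode_apply,
      map_zero, sub_zero, map_zero, smul_zero, add_zero, hR]
    module
  have hbij : Function.Bijective f := by
    have h1 : J ∘ f = shift (mainOp S) α ∘ resolventMap (mainOp S) β := by
      funext x
      rw [Function.comp_apply, Function.comp_apply, hJf, shift_apply, apply_resolventMap hβ, hR]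
      module
    have h2 : Function.Bijective (J ∘ f) := h1 ▸ hα.comp (resolventMap_bijective hβ)
    exact (Function.Bijective.of_comp_iff' J.bijective f).mp h2
  refine (linInv_eq_iff hbij).mpr (J.injective ?_)
  rw [hJf, hT.apply_eq hD hG hβ hR hJ, resolventNode_apply, zero_sub, map_neg]
  module

end nodes

/-! ### The disk model -/

section disk

open Topology Filter

variable {U Y : Type*} [NormedAddCommGroup U] [InnerProductSpace ℂ U] [CompleteSpace U]
  [NormedAddCommGroup Y] [InnerProductSpace ℂ Y] [CompleteSpace Y]

theorem Schur.continuous_restrict {U Y : Type*} [NormedAddCommGroup U] [InnerProductSpace ℂ U]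
    [NormedAddCommGroup Y] [InnerProductSpace ℂ Y] {Ω : Set ℂ} (φ : Schur Ω U Y) :
    Continuous fun z : Ω => φ.toFun z :=
  continuousOn_iff_continuous_domRestrict.mp φ.differentiableOn.continuousOn

theorem Schur.continuous_comp_adjoint {Ω : Set ℂ} (φ : Schur Ω U Y) :
    Continuous fun p : Ω × Ω => (1 : Y →L[ℂ] Y) - φ.toFun p.1 ∘L (φ.toFun p.2).adjoint := by
  have h1 : Continuous fun p : Ω × Ω => φ.toFun p.1 :=
    φ.continuous_restrict.comp continuous_fst
  have h2 : Continuous fun p : Ω × Ω => (φ.toFun p.2).adjoint :=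
    ContinuousLinearMap.adjoint.continuous.comp (φ.continuous_restrict.comp continuous_snd)
  exact continuous_const.sub (h1.clm_comp h2)

theorem one_sub_mul_conj_ne_zero (z w : unitDisk) : 1 - (z : ℂ) * conj (w : ℂ) ≠ 0 := by
  have hz : ‖(z : ℂ)‖ < 1 := by simpa [unitDisk] using z.2
  have hw : ‖(w : ℂ)‖ < 1 := by simpa [unitDisk] using w.2
  simpa using den_ne one_pos hw hz.le

theorem continuous_diskSpace (φ : Schur unitDisk U Y) (f : DiskSpace φ) : Continuous f := by
  refine continuous_of_continuous_kernel ?_ f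
  rw [kernel_diskSpace]
  refine Continuous.smul (Continuous.inv₀ ?_ fun p => one_sub_mul_conj_ne_zero p.1 p.2)
    φ.continuous_comp_adjoint
  exact continuous_const.sub ((continuous_subtype_val.comp continuous_fst).mul
    (Complex.continuous_conj.comp (continuous_subtype_val.comp continuous_snd)))

theorem add_conj_ne_zero (μ ν : rightHalfPlane) : (μ : ℂ) + conj (ν : ℂ) ≠ 0 := by
  rw [add_comm]
  exact conj_add_ne_zero ν μ

theorem continuous_halfPlaneSpace (φ : Schur rightHalfPlane U Y) (x : HalfPlaneSpace φ) :
    Continuous x := by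
  refine continuous_of_continuous_kernel ?_ x
  rw [kernel_halfPlaneSpace]
  refine Continuous.smul (Continuous.inv₀ ?_ fun p => add_conj_ne_zero p.1 p.2)
    φ.continuous_comp_adjoint
  exact (continuous_subtype_val.comp continuous_fst).add
    (Complex.continuous_conj.comp (continuous_subtype_val.comp continuous_snd))

theorem isOpen_rightHalfPlane : IsOpen rightHalfPlane :=
  isOpen_lt continuous_const Complex.continuous_re

theorem nhdsWithin_subtype_neBot {Ω : Set ℂ} (hΩ : IsOpen Ω) (a : Ω) :
    (𝓝[{a}ᶜ] a).NeBot := by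
  have h := hΩ.isOpenEmbedding_subtypeVal.map_nhdsWithin_preimage_eq {(a : ℂ)}ᶜ a
  have h1 : (Subtype.val ⁻¹' {(a : ℂ)}ᶜ : Set Ω) = {a}ᶜ := by
    ext z
    simp [Subtype.ext_iff]
  rw [h1] at h
  rw [← Filter.map_neBot_iff (Subtype.val : Ω → ℂ), h]
  infer_instance

theorem isRemovableExtension_of_continuous {Ω : Set ℂ} {E : Type*} [NormedAddCommGroup E]
    {f g : Ω → E} {a : Ω} (hf : Continuous f) (h : ∀ z : Ω, z ≠ a → f z = g z) :
    IsRemovableExtension f g a :=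
  ⟨h, (hf.continuousAt.tendsto.mono_left nhdsWithin_le_nhds).congr'
    (eventually_nhdsWithin_of_forall h)⟩

/-- Continuous functions on an open subset of the plane that agree off a point are equal. -/
theorem eq_of_eq_off_point {Ω : Set ℂ} (hΩ : IsOpen Ω) {E : Type*} [NormedAddCommGroup E]
    {f g : Ω → E} {a : Ω} (hf : Continuous f) (hg : Continuous g)
    (h : ∀ z : Ω, z ≠ a → f z = g z) : f = g := by
  have hne := nhdsWithin_subtype_neBot hΩ a
  funext z
  by_cases hz : z = a
  · subst hz
    exact tendsto_nhds_unique (isRemovableExtension_of_continuous hf h).2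
      (hg.continuousAt.tendsto.mono_left nhdsWithin_le_nhds)
  · exact h z hz

/-- The bounded operators `A, B, C, D` satisfy `z g(z) + h = f(z) + φ(z) u` for `g = A f + B u` and
`h = C f + D u`, and `A` is a contraction. -/
structure IsDiskColligation (φ : Schur unitDisk U Y) (A : DiskSpace φ →L[ℂ] DiskSpace φ)
    (B : U →L[ℂ] DiskSpace φ) (C : DiskSpace φ →L[ℂ] Y) (D : U →L[ℂ] Y) : Prop where
  rel : ∀ f u (z : unitDisk), (z : ℂ) • (A f + B u) z + (C f + D u) = f z + φ.toFun z u
  norm_le : ∀ f, ‖A f‖ ≤ ‖f‖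

/-- The identity `(1 - z w̄) K(z, w) = 1 - φ(z) φ(w)*` says that `(w̄ k_w y, y) ↦ (k_w y, φ(w)* y)`
preserves inner products. It extends to an isometry from `H ⊕ Y` to `H ⊕ U`, the adjoint of which
is the colligation. -/
theorem exists_isDiskColligation (φ : Schur unitDisk U Y) :
    ∃ A B C D, IsDiskColligation φ A B C D := by
  set k := RKHS.kerFun (DiskSpace φ) with hk
  set a : unitDisk × Y → WithLp 2 (DiskSpace φ × Y) := fun p =>
    WithLp.toLp 2 (conj (p.1 : ℂ) • k p.1 p.2, p.2) with ha
  set b : unitDisk × Y → WithLp 2 (DiskSpace φ × U) := fun p =>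
    WithLp.toLp 2 (k p.1 p.2, (φ.toFun p.1).adjoint p.2) with hb
  have hax : ∀ p x, ⟪a p, x⟫_ℂ = ⟪p.2, (p.1 : ℂ) • x.fst p.1 + x.snd⟫_ℂ := by
    intro p x
    rw [WithLp.prod_inner_apply, inner_add_right, inner_smul_right]
    simp only [ha, hk, inner_smul_left, RKHS.kerFun_inner, Complex.conj_conj]
    rfl
  have hbx : ∀ p x, ⟪b p, x⟫_ℂ = ⟪p.2, x.fst p.1 + φ.toFun p.1 x.snd⟫_ℂ := by
    intro p x
    rw [WithLp.prod_inner_apply, inner_add_right]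
    simp only [hb, hk, RKHS.kerFun_inner, ContinuousLinearMap.adjoint_inner_left]
    rfl
  have hgram : ∀ p q, ⟪a p, a q⟫_ℂ = ⟪b p, b q⟫_ℂ := by
    rintro ⟨z, y⟩ ⟨w, y'⟩
    rw [hax, hbx]
    congr 1
    have h0 := one_sub_mul_conj_ne_zero z w
    have h1 : k w y' z = (1 - (z : ℂ) * conj (w : ℂ))⁻¹ •
        (y' - φ.toFun z ((φ.toFun w).adjoint y')) := by
      rw [hk, RKHS.kerFun_apply, kernel_diskSpace]; rfl
    have h2 : φ.toFun z ((φ.toFun w).adjoint y') = y' - (1 - (z : ℂ) * conj (w : ℂ)) • k w y' z := by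
      rw [h1, smul_inv_smul₀ h0, sub_sub_cancel]
    change (z : ℂ) • (conj (w : ℂ) • k w y') z + y'
      = k w y' z + φ.toFun z ((φ.toFun w).adjoint y')
    rw [h2, RKHS.coe_smul, Pi.smul_apply]
    module
  have htot : ∀ x, (∀ p, ⟪a p, x⟫_ℂ = 0) → x = 0 := by
    intro x hx
    have h1 : ∀ z : unitDisk, (z : ℂ) • x.fst z + x.snd = 0 := fun z =>
      ext_inner_left ℂ fun y => by rw [inner_zero_right, ← hax (z, y), hx]
    have h2 : x.snd = 0 := by simpa [diskZero] using h1 diskZero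
    have h3 : (x.fst : unitDisk → Y) = 0 := by
      refine eq_of_eq_off_point Metric.isOpen_ball (a := diskZero)
        (continuous_diskSpace φ _) continuous_const fun z hz => ?_
      have hz0 : (z : ℂ) ≠ 0 := fun h => hz (Subtype.ext h)
      have h4 := h1 z
      rw [h2, add_zero] at h4
      exact (smul_eq_zero.mp h4).resolve_left hz0
    have h4 : x.fst = 0 := RKHS.ext fun z => by rw [h3, RKHS.coe_zero]
    exact (WithLp.ofLp_injective 2) (Prod.ext h4 h2)
  obtain ⟨V, hV⟩ := exists_linearIsometry_of_gram_eq a b hgram htot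
  set W := V.toContinuousLinearMap.adjoint with hW
  have hrel : ∀ x (z : unitDisk),
      (z : ℂ) • (W x).fst z + (W x).snd = x.fst z + φ.toFun z x.snd := by
    intro x z
    refine ext_inner_left ℂ fun y => ?_
    rw [← hax (z, y), ← hbx (z, y), ← hV, ContinuousLinearMap.adjoint_inner_right]
    rfl
  set W' : DiskSpace φ × U →L[ℂ] DiskSpace φ × Y :=
    (WithLp.prodContinuousLinearEquiv 2 ℂ (DiskSpace φ) Y : _ →L[ℂ] _) ∘L W ∘L
      ((WithLp.prodContinuousLinearEquiv 2 ℂ (DiskSpace φ) U).symm : _ →L[ℂ] _) with hW'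
  refine ⟨.fst ℂ _ _ ∘L W' ∘L .inl ℂ _ _, .fst ℂ _ _ ∘L W' ∘L .inr ℂ _ _,
    .snd ℂ _ _ ∘L W' ∘L .inl ℂ _ _, .snd ℂ _ _ ∘L W' ∘L .inr ℂ _ _, ?_, ?_⟩
  · intro f u z
    have h1 : W' (f, u) = W' (f, 0) + W' (0, u) := by rw [← map_add]; simp
    have h2 := hrel (WithLp.toLp 2 (f, u)) z
    have h3 : (z : ℂ) • (W' (f, u)).1 z + (W' (f, u)).2 = f z + φ.toFun z u := h2
    rw [h1] at h3
    exact h3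
  · intro f
    have h1 : ‖(W (WithLp.toLp 2 (f, (0 : U)))).fst‖ ≤ ‖W (WithLp.toLp 2 (f, (0 : U)))‖ := by
      rw [WithLp.prod_norm_eq_of_L2]
      exact Real.le_sqrt_of_sq_le (by nlinarith [norm_nonneg (W (WithLp.toLp 2 (f, (0 : U)))).snd])
    have h2 : ‖W‖ ≤ 1 := by
      rw [hW, LinearIsometryEquiv.norm_map]
      exact V.norm_toContinuousLinearMap_le
    have h3 : ‖(WithLp.toLp 2 (f, (0 : U)) : WithLp 2 (DiskSpace φ × U))‖ = ‖f‖ := by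
      rw [WithLp.prod_norm_eq_of_L2]
      simp
    refine h1.trans ((W.le_of_opNorm_le h2 _).trans ?_)
    rw [h3, one_mul]

theorem IsDiskColligation.isDiskModel {φ : Schur unitDisk U Y} {A : DiskSpace φ →L[ℂ] DiskSpace φ}
    {B : U →L[ℂ] DiskSpace φ} {C : DiskSpace φ →L[ℂ] Y} {D : U →L[ℂ] Y}
    (h : IsDiskColligation φ A B C D) : IsDiskModel φ A B C D := by
  have hC : ∀ f, C f = f diskZero := fun f => by
    simpa [diskZero] using h.rel f 0 diskZero
  have hD : ∀ u, D u = φ.toFun 0 u := fun u => by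
    simpa [diskZero] using h.rel 0 u diskZero
  have hne : ∀ z : unitDisk, z ≠ diskZero → (z : ℂ) ≠ 0 := fun z hz h => hz (Subtype.ext h)
  refine ⟨fun f => ?_, fun u => ?_, hC, hD⟩
  · refine isRemovableExtension_of_continuous (continuous_diskSpace φ _) fun z hz => ?_
    have h1 := h.rel f 0 z
    simp only [map_zero, add_zero] at h1
    rw [eq_inv_smul_iff₀ (hne z hz), ← h1, hC, add_sub_cancel_right]
  · refine isRemovableExtension_of_continuous (continuous_diskSpace φ _) fun z hz => ?_
    have h1 := h.rel 0 u z
    simp only [map_zero, zero_add, RKHS.coe_zero, Pi.zero_apply] at h1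
    rw [eq_inv_smul_iff₀ (hne z hz), ← h1, hD, add_sub_cancel_right]

end disk

/-! ### The half-plane colligation -/

section halfplane

variable {U Y : Type*} [NormedAddCommGroup U] [InnerProductSpace ℂ U] [CompleteSpace U]
  [NormedAddCommGroup Y] [InnerProductSpace ℂ Y] [CompleteSpace Y]

theorem toDisk_toHalfPlane (α : rightHalfPlane) (z : unitDisk) :
    toDisk α (toHalfPlane α z) = z := by
  apply Subtype.ext
  have h0 := one_add_ne_zero z.2
  have h1 : conj (α : ℂ) + (toHalfPlane α z : ℂ) ≠ 0 := conj_add_ne_zero α _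
  simp only [toDisk]
  rw [div_eq_iff h1]
  simp only [toHalfPlane]
  field_simp
  ring

theorem onDisk_toDisk {U Y : Type*} [NormedAddCommGroup U] [InnerProductSpace ℂ U]
    [NormedAddCommGroup Y] [InnerProductSpace ℂ Y] (φ : Schur rightHalfPlane U Y) (α μ : rightHalfPlane) :
    (φ.onDisk α).toFun (toDisk α μ) = φ.toFun μ :=
  congrArg (fun ν : rightHalfPlane => φ.toFun ν) (toHalfPlane_toDisk α μ)

theorem sqrt_two_re_mul_self (α : rightHalfPlane) :
    (√(2 * (α : ℂ).re) : ℂ) * (√(2 * (α : ℂ).re) : ℂ) = α + conj (α : ℂ) := by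
  have h : 0 < (α : ℂ).re := α.2
  rw [← Complex.ofReal_mul, Real.mul_self_sqrt (by positivity), Complex.add_conj]

theorem sqrt_two_re_ne_zero (α : rightHalfPlane) : (√(2 * (α : ℂ).re) : ℂ) ≠ 0 := by
  have h : 0 < (α : ℂ).re := α.2
  exact_mod_cast (Real.sqrt_pos.mpr (by positivity)).ne'

theorem halfPlaneKernel_eq (φ : Schur rightHalfPlane U Y) (α μ ν : rightHalfPlane) :
    halfPlaneKernel φ μ ν = ((√(2 * (α : ℂ).re) : ℂ) / (conj (α : ℂ) + μ) *
      conj ((√(2 * (α : ℂ).re) : ℂ) / (conj (α : ℂ) + ν))) •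
        diskKernel (φ.onDisk α) (toDisk α μ) (toDisk α ν) := by
  simp only [halfPlaneKernel, diskKernel, Matrix.of_apply, onDisk_toDisk, smul_smul]
  congr 1
  have hμ := conj_add_ne_zero α μ
  have hν : (α : ℂ) + conj (ν : ℂ) ≠ 0 := add_conj_ne_zero α ν
  have hμν := add_conj_ne_zero μ ν
  have hα := add_conj_ne_zero α α
  have h1 : 1 - (toDisk α μ : ℂ) * conj (toDisk α ν : ℂ)
      = (α + conj (α : ℂ)) * (μ + conj (ν : ℂ)) / ((conj (α : ℂ) + μ) * (α + conj (ν : ℂ))) := by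
    simp only [toDisk, map_div₀, map_sub, map_add, Complex.conj_conj]
    field_simp
    ring
  rw [h1]
  simp only [map_div₀, map_add, Complex.conj_conj, Complex.conj_ofReal]
  rw [div_mul_div_comm, sqrt_two_re_mul_self]
  field_simp

/-- The unitary operator `ξ ↦ √(2 Re α) / (ᾱ + μ) ξ(z_α(μ))`. -/
theorem exists_diskSpace_equiv (φ : Schur rightHalfPlane U Y) (α : rightHalfPlane) :
    ∃ Ξ : DiskSpace (φ.onDisk α) ≃ₗᵢ[ℂ] HalfPlaneSpace φ, ∀ ξ μ,
      Ξ ξ μ = ((√(2 * (α : ℂ).re) : ℂ) / (conj (α : ℂ) + μ)) • ξ (toDisk α μ) := by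
  refine exists_unitary_of_kernel_eq (e := toDisk α)
    (fun z => ⟨toHalfPlane α z, toDisk_toHalfPlane α z⟩)
    (fun μ => div_ne_zero (sqrt_two_re_ne_zero α) (conj_add_ne_zero α μ)) fun μ ν => ?_
  rw [kernel_halfPlaneSpace, kernel_diskSpace]
  exact halfPlaneKernel_eq φ α μ ν

theorem diskSpace_equiv_symm_apply {φ : Schur rightHalfPlane U Y} {α : rightHalfPlane}
    {Ξ : DiskSpace (φ.onDisk α) ≃ₗᵢ[ℂ] HalfPlaneSpace φ}
    (hΞ : ∀ ξ μ, Ξ ξ μ = ((√(2 * (α : ℂ).re) : ℂ) / (conj (α : ℂ) + μ)) • ξ (toDisk α μ))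
    (ζ : HalfPlaneSpace φ) (z : unitDisk) :
    Ξ.symm ζ z = ((√(2 * (α : ℂ).re) : ℂ) / (1 + (z : ℂ))) • ζ (toHalfPlane α z) := by
  obtain ⟨ξ, rfl⟩ := Ξ.surjective ζ
  rw [Ξ.symm_apply_apply, hΞ, toDisk_toHalfPlane, smul_smul]
  have h0 := one_add_ne_zero z.2
  have hα := add_conj_ne_zero α α
  have h1 : conj (α : ℂ) + (toHalfPlane α z : ℂ) = (α + conj (α : ℂ)) / (1 + z) := by
    simp only [toHalfPlane]
    field_simp
    ring
  have h2 : (√(2 * (α : ℂ).re) : ℂ) / (1 + (z : ℂ)) *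
      ((√(2 * (α : ℂ).re) : ℂ) / (conj (α : ℂ) + (toHalfPlane α z : ℂ))) = 1 := by
    rw [div_mul_div_comm, sqrt_two_re_mul_self, h1]
    field_simp
  rw [h2, one_smul]

/-- The bounded operators satisfy
`(α - μ) x'(μ) + √(2 Re α) h = (ᾱ + μ) x(μ) + √(2 Re α) φ(μ) u` for `x' = cA x + cB u` and
`h = cC x + cD u`, and `cA` is a contraction. -/
structure IsHalfPlaneColligation (φ : Schur rightHalfPlane U Y) (α : rightHalfPlane)
    (cA : HalfPlaneSpace φ →L[ℂ] HalfPlaneSpace φ) (cB : U →L[ℂ] HalfPlaneSpace φ)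
    (cC : HalfPlaneSpace φ →L[ℂ] Y) (cD : U →L[ℂ] Y) : Prop where
  rel : ∀ x u (μ : rightHalfPlane), ((α : ℂ) - μ) • (cA x + cB u) μ
    + (√(2 * (α : ℂ).re) : ℂ) • (cC x + cD u)
    = (conj (α : ℂ) + μ) • x μ + (√(2 * (α : ℂ).re) : ℂ) • φ.toFun μ u
  norm_le : ∀ x, ‖cA x‖ ≤ ‖x‖

/-- The unitary operator carries a disk colligation to a half-plane colligation. -/
theorem IsDiskColligation.isHalfPlaneColligation {φ : Schur rightHalfPlane U Y}
    {α : rightHalfPlane} {Ξ : DiskSpace (φ.onDisk α) ≃ₗᵢ[ℂ] HalfPlaneSpace φ}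
    (hΞ : ∀ ξ μ, Ξ ξ μ = ((√(2 * (α : ℂ).re) : ℂ) / (conj (α : ℂ) + μ)) • ξ (toDisk α μ))
    {A : DiskSpace (φ.onDisk α) →L[ℂ] DiskSpace (φ.onDisk α)}
    {B : U →L[ℂ] DiskSpace (φ.onDisk α)} {C : DiskSpace (φ.onDisk α) →L[ℂ] Y} {D : U →L[ℂ] Y}
    (h : IsDiskColligation (φ.onDisk α) A B C D) :
    IsHalfPlaneColligation φ α
      ((Ξ : _ →L[ℂ] HalfPlaneSpace φ) ∘L A ∘L (Ξ.symm : HalfPlaneSpace φ →L[ℂ] _))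
      ((Ξ : _ →L[ℂ] HalfPlaneSpace φ) ∘L B)
      (C ∘L (Ξ.symm : HalfPlaneSpace φ →L[ℂ] _)) D := by
  refine ⟨fun x u μ => ?_, fun x => ?_⟩
  · obtain ⟨ξ, rfl⟩ := Ξ.surjective x
    have h1 := h.rel ξ u (toDisk α μ)
    have h2 : (((Ξ : _ →L[ℂ] HalfPlaneSpace φ) ∘L A ∘L (Ξ.symm : HalfPlaneSpace φ →L[ℂ] _)) (Ξ ξ)
        + ((Ξ : _ →L[ℂ] HalfPlaneSpace φ) ∘L B) u) = Ξ (A ξ + B u) := by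
      simp
    have h3 : (C ∘L (Ξ.symm : HalfPlaneSpace φ →L[ℂ] _)) (Ξ ξ) = C ξ := by simp
    rw [h2, h3, hΞ, hΞ]
    rw [onDisk_toDisk, ← eq_sub_iff_add_eq'] at h1
    have h0 := conj_add_ne_zero α μ
    have hz : ((α : ℂ) - μ) = (conj (α : ℂ) + μ) * (toDisk α μ : ℂ) := by
      simp only [toDisk]
      field_simp
    rw [hz, h1, smul_smul, smul_smul, mul_div_cancel₀ _ h0, mul_right_comm, mul_div_cancel₀ _ h0]
    module
  · simpa using h.norm_le (Ξ.symm x)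

theorem exists_isHalfPlaneColligation (φ : Schur rightHalfPlane U Y) (α : rightHalfPlane) :
    ∃ cA cB cC cD, IsHalfPlaneColligation φ α cA cB cC cD := by
  obtain ⟨Ξ, hΞ⟩ := exists_diskSpace_equiv φ α
  obtain ⟨A, B, C, D, h⟩ := exists_isDiskColligation (φ.onDisk α)
  exact ⟨_, _, _, _, h.isHalfPlaneColligation hΞ⟩

namespace IsHalfPlaneColligation

variable {φ : Schur rightHalfPlane U Y} {α : rightHalfPlane}
  {cA : HalfPlaneSpace φ →L[ℂ] HalfPlaneSpace φ} {cB : U →L[ℂ] HalfPlaneSpace φ}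
  {cC : HalfPlaneSpace φ →L[ℂ] Y} {cD : U →L[ℂ] Y}

theorem isExplicitCayley (h : IsHalfPlaneColligation φ α cA cB cC cD) :
    IsExplicitCayley φ α cA cB cC cD := by
  have hr := sqrt_two_re_ne_zero α
  have hrr := sqrt_two_re_mul_self α
  have hC : ∀ x, cC x = (√(2 * (α : ℂ).re) : ℂ) • x α := fun x => by
    have h1 := h.rel x 0 α
    simp only [sub_self, zero_smul, zero_add, map_zero, add_zero, smul_zero] at h1
    rw [add_comm, ← hrr, mul_smul] at h1
    exact smul_right_injective _ hr h1
  have hD : ∀ u, cD u = φ.toFun α u := fun u => by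
    have h1 := h.rel 0 u α
    simp only [sub_self, zero_smul, zero_add, map_zero, RKHS.coe_zero, Pi.zero_apply,
      smul_zero] at h1
    exact smul_right_injective _ hr h1
  have hne : ∀ μ : rightHalfPlane, μ ≠ α → (α : ℂ) - μ ≠ 0 := fun μ hμ h =>
    hμ (Subtype.ext (sub_eq_zero.mp h).symm)
  refine ⟨fun x => ?_, fun u => ?_, hC, hD⟩
  · refine isRemovableExtension_of_continuous (continuous_halfPlaneSpace φ _) fun μ hμ => ?_
    have h1 := h.rel x 0 μ
    simp only [map_zero, add_zero, smul_zero] at h1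
    rw [hC, smul_smul, hrr, ← eq_sub_iff_add_eq] at h1
    rw [div_eq_inv_mul, div_eq_inv_mul, mul_smul, mul_smul, ← smul_sub,
      eq_inv_smul_iff₀ (hne μ hμ), h1, Complex.add_conj]
  · refine isRemovableExtension_of_continuous (continuous_halfPlaneSpace φ _) fun μ hμ => ?_
    have h1 := h.rel 0 u μ
    simp only [map_zero, zero_add, RKHS.coe_zero, Pi.zero_apply, smul_zero] at h1
    rw [← eq_sub_iff_add_eq, ← smul_sub, hD] at h1
    rw [mul_comm, mul_smul, eq_inv_smul_iff₀ (hne μ hμ), h1]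

/-- The operators of a half-plane colligation parametrize the graph of the model. -/
theorem mem_graph_obsNode (h : IsHalfPlaneColligation φ α cA cB cC cD) (x : HalfPlaneSpace φ)
    (u : U) :
    ((x + (cA x + cB u), (√(2 * (α : ℂ).re) : ℂ) • u),
      ((α : ℂ) • (cA x + cB u) - conj (α : ℂ) • x, (√(2 * (α : ℂ).re) : ℂ) • (cC x + cD u)))
      ∈ (obsNode φ).graph := by
  rw [graph_obsNode]
  intro μ
  have h1 := h.rel x u μ
  rw [← eq_sub_iff_add_eq'] at h1
  simp only [RKHS.coe_sub, RKHS.coe_smul, RKHS.coe_add, Pi.sub_apply, Pi.smul_apply, Pi.add_apply,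
    map_smul] at h1 ⊢
  have h2 : (√(2 * (α : ℂ).re) : ℂ) • (φ.toFun μ) u = ((α : ℂ) - μ) • (cA x μ + cB u μ)
      + (√(2 * (α : ℂ).re) : ℂ) • (cC x + cD u) - (conj (α : ℂ) + μ) • x μ := by
    rw [h1]
    abel
  rw [h2]
  module

theorem mem_graph_mainOp (h : IsHalfPlaneColligation φ α cA cB cC cD) (x : HalfPlaneSpace φ) :
    (x + cA x, (α : ℂ) • cA x - conj (α : ℂ) • x) ∈ (mainOp (obsNode φ)).graph := by
  have h1 := h.mem_graph_obsNode x 0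
  rw [map_zero, map_zero, add_zero, add_zero, smul_zero] at h1
  exact mem_graph_mainOp_iff.mpr ⟨_, h1⟩

end IsHalfPlaneColligation

/-! ### The observable model as a system node -/

theorem isClosed_obsNode (φ : Schur rightHalfPlane U Y) : (obsNode φ).IsClosed := by
  rw [LinearPMap.IsClosed, graph_obsNode]
  have h1 : ((obsGraph φ : Submodule ℂ _) : Set ((HalfPlaneSpace φ × U) × (HalfPlaneSpace φ × Y)))
      = ⋂ μ : rightHalfPlane, {p | p.2.1 μ = (μ : ℂ) • p.1.1 μ + φ.toFun μ p.1.2 - p.2.2} := by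
    ext p
    simp only [Set.mem_iInter]
    rfl
  rw [h1]
  refine isClosed_iInter fun μ => isClosed_eq ?_ ?_
  · exact (RKHS.continuous_eval μ).comp (continuous_fst.comp continuous_snd)
  · have h2 : Continuous fun p : (HalfPlaneSpace φ × U) × (HalfPlaneSpace φ × Y) => p.1.1 μ :=
      (RKHS.continuous_eval μ).comp (continuous_fst.comp continuous_fst)
    fun_prop

/-- Every point of the right half-plane is in the resolvent set of the model. An eigenvector would
satisfy `(α - μ) x(μ) = 0`. -/
theorem mem_resSet_obsNode (φ : Schur rightHalfPlane U Y) (α : rightHalfPlane) :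
    (α : ℂ) ∈ resSet (mainOp (obsNode φ)) := by
  have hα := add_conj_ne_zero α α
  constructor
  · rw [injective_iff_map_eq_zero]
    intro x hx
    rw [shift_apply, sub_eq_zero] at hx
    have h1 := mem_graph_of_mem_domain_mainOp x
    rw [graph_obsNode, ← hx] at h1
    set y := observationOp (obsNode φ) x with hy
    have h2 : ∀ μ : rightHalfPlane, ((α : ℂ) - μ) • (x : HalfPlaneSpace φ) μ = - y := fun μ => by
      have h3 : ((α : ℂ) • (x : HalfPlaneSpace φ)) μ
        = (μ : ℂ) • (x : HalfPlaneSpace φ) μ + φ.toFun μ 0 - y := h1 μ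
      rw [RKHS.coe_smul, Pi.smul_apply, map_zero, add_zero] at h3
      rw [sub_smul, h3]
      abel
    have h4 : y = 0 := by simpa using (h2 α).symm
    have h5 : ((x : HalfPlaneSpace φ) : rightHalfPlane → Y) = 0 := by
      refine eq_of_eq_off_point isOpen_rightHalfPlane (a := α) (continuous_halfPlaneSpace φ _)
        continuous_const fun μ hμ => ?_
      have h6 := h2 μ
      rw [h4, neg_zero] at h6
      exact (smul_eq_zero.mp h6).resolve_left fun h0 =>
        hμ (Subtype.ext (sub_eq_zero.mp h0).symm)
    exact Subtype.ext (RKHS.ext fun μ => by rw [h5]; simp)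
  · intro w
    obtain ⟨cA, cB, cC, cD, h⟩ := exists_isHalfPlaneColligation φ α
    obtain ⟨ξ, h1, h2⟩ := (LinearPMap.mem_graph_iff _).mp
      (h.mem_graph_mainOp (((α : ℂ) + conj (α : ℂ))⁻¹ • w))
    refine ⟨ξ, ?_⟩
    rw [shift_apply, h1, h2]
    have h3 : ∀ x y : HalfPlaneSpace φ, (α : ℂ) • (x + y) - ((α : ℂ) • y - conj (α : ℂ) • x)
      = ((α : ℂ) + conj (α : ℂ)) • x := fun x y => by module
    rw [h3, smul_inv_smul₀ hα]

theorem IsHalfPlaneColligation.resolvent_eq {φ : Schur rightHalfPlane U Y} {α : rightHalfPlane}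
    {cA : HalfPlaneSpace φ →L[ℂ] HalfPlaneSpace φ} {cB : U →L[ℂ] HalfPlaneSpace φ}
    {cC : HalfPlaneSpace φ →L[ℂ] Y} {cD : U →L[ℂ] Y}
    (h : IsHalfPlaneColligation φ α cA cB cC cD) (x : HalfPlaneSpace φ) :
    (resolventMap (mainOp (obsNode φ)) α x : HalfPlaneSpace φ)
      = ((α : ℂ) + conj (α : ℂ))⁻¹ • (x + cA x) := by
  have hα := add_conj_ne_zero α α
  obtain ⟨ξ, h1, h2⟩ := (LinearPMap.mem_graph_iff _).mp
    (h.mem_graph_mainOp (((α : ℂ) + conj (α : ℂ))⁻¹ • x))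
  have h3 : resolventMap (mainOp (obsNode φ)) α x = ξ := by
    rw [resolventMap_eq_iff (mem_resSet_obsNode φ α), h1, h2]
    have h3 : ∀ x y : HalfPlaneSpace φ, (α : ℂ) • (x + y) - ((α : ℂ) • y - conj (α : ℂ) • x)
      = ((α : ℂ) + conj (α : ℂ)) • x := fun x y => by module
    rw [h3, smul_inv_smul₀ hα]
  rw [h3, h1, map_smul, smul_add]

/-- `cA` is the Cayley transform `(ᾱ + A)(α - A)⁻¹` of the main operator. -/
theorem IsHalfPlaneColligation.A_eq {φ : Schur rightHalfPlane U Y} {α : rightHalfPlane}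
    {cA : HalfPlaneSpace φ →L[ℂ] HalfPlaneSpace φ} {cB : U →L[ℂ] HalfPlaneSpace φ}
    {cC : HalfPlaneSpace φ →L[ℂ] Y} {cD : U →L[ℂ] Y}
    (h : IsHalfPlaneColligation φ α cA cB cC cD) (x : HalfPlaneSpace φ) :
    cA x = conj (α : ℂ) • (resolventMap (mainOp (obsNode φ)) α x : HalfPlaneSpace φ)
      + mainOp (obsNode φ) (resolventMap (mainOp (obsNode φ)) α x) := by
  rw [apply_resolventMap (mem_resSet_obsNode φ α), ← add_sub_assoc, ← add_smul, h.resolvent_eq,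
    add_comm (conj (α : ℂ)), smul_inv_smul₀ (add_conj_ne_zero α α), add_sub_cancel_left]

/-- An operator with contractive Cayley transform is dissipative, since
`‖α x - A x‖² - ‖ᾱ x + A x‖² = -4 Re α Re ⟪A x, x⟫`. -/
theorem re_inner_nonpos_of_norm_le {X : Type*} [NormedAddCommGroup X] [InnerProductSpace ℂ X]
    {α : ℂ} (hα : 0 < α.re) {x z : X} (h : ‖conj α • x + z‖ ≤ ‖α • x - z‖) :
    (⟪z, x⟫_ℂ).re ≤ 0 := by
  have h1 := pow_le_pow_left₀ (norm_nonneg _) h 2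
  have h2 := norm_add_sq (𝕜 := ℂ) (conj α • x) z
  have h3 := norm_sub_sq (𝕜 := ℂ) (α • x) z
  have h4 : (⟪conj α • x, z⟫_ℂ).re + (⟪α • x, z⟫_ℂ).re = 2 * α.re * (⟪z, x⟫_ℂ).re := by
    have h5 : (⟪x, z⟫_ℂ).re = (⟪z, x⟫_ℂ).re := by rw [← inner_conj_symm, Complex.conj_re]
    rw [inner_smul_left, inner_smul_left, ← h5]
    simp
    ring
  simp only [RCLike.re_eq_complex_re, norm_smul, RCLike.norm_conj] at h2 h3
  nlinarith

theorem dissipative_obsNode (φ : Schur rightHalfPlane U Y)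
    (x : (mainOp (obsNode φ)).domain) :
    (⟪mainOp (obsNode φ) x, (x : HalfPlaneSpace φ)⟫_ℂ).re ≤ 0 := by
  set α : rightHalfPlane := ⟨1, by simp [rightHalfPlane]⟩
  obtain ⟨cA, cB, cC, cD, h⟩ := exists_isHalfPlaneColligation φ α
  refine re_inner_nonpos_of_norm_le α.2 ?_
  have h1 := h.norm_le ((α : ℂ) • (x : HalfPlaneSpace φ) - mainOp (obsNode φ) x)
  rwa [h.A_eq, resolventMap_shift (mem_resSet_obsNode φ α)] at h1

/-- The model of `φ` is a system node whose internal Cayley transform is the half-plane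
colligation. -/
theorem IsHalfPlaneColligation.isInternalCayleyTransform {φ : Schur rightHalfPlane U Y}
    {α : rightHalfPlane} {cA : HalfPlaneSpace φ →L[ℂ] HalfPlaneSpace φ}
    {cB : U →L[ℂ] HalfPlaneSpace φ} {cC : HalfPlaneSpace φ →L[ℂ] Y} {cD : U →L[ℂ] Y}
    (h : IsHalfPlaneColligation φ α cA cB cC cD) :
    IsInternalCayleyTransform (obsNode φ) α cA cB cC cD := by
  have hr := sqrt_two_re_ne_zero α
  have hα := mem_resSet_obsNode φ α
  have hgen : IsC0Generator (mainOp (obsNode φ)) :=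
    isC0Generator_of_dissipative (dissipative_obsNode φ) fun r hr0 =>
      mem_resSet_obsNode φ ⟨r, hr0⟩
  have hD := dense_domain_of_dissipative (dissipative_obsNode φ) hα α.2
  have hRα : ∀ x, (((α : ℂ) + conj (α : ℂ))⁻¹ • (1 + cA)) x
      = resolventMap (mainOp (obsNode φ)) α x := fun x => (h.resolvent_eq x).symm
  set G : U →L[ℂ] HalfPlaneSpace φ := (√(2 * (α : ℂ).re) : ℂ)⁻¹ • cB with hGdef
  have hG' : ∀ u, ((G u, u), ((α : ℂ) • G u, cD u)) ∈ (obsNode φ).graph := fun u => by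
    have h1 := h.mem_graph_obsNode 0 ((√(2 * (α : ℂ).re) : ℂ)⁻¹ • u)
    simp only [map_zero, zero_add, smul_zero, sub_zero, map_smul, smul_inv_smul₀ hr] at h1
    exact h1
  have hG : ∀ u, ∃ y, ((G u, u), ((α : ℂ) • G u, y)) ∈ (obsNode φ).graph := fun u => ⟨_, hG' u⟩
  refine ⟨isSystemNode_of_exists (isClosed_obsNode φ) hgen hD hα hRα hG, hα, h.A_eq, ?_, ?_, ?_⟩
  · intro β hβ T hT u
    rw [extrapolatedResolventB_eq hD hα hRα hG hβ hT]
    exact (smul_inv_smul₀ hr _).symm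
  · intro x
    set ξ := resolventMap (mainOp (obsNode φ)) α x with hξ
    have h1 := mem_graph_of_mem_domain_mainOp ξ
    have h2 := h.mem_graph_obsNode (((α : ℂ) + conj (α : ℂ))⁻¹ • x) 0
    rw [map_zero, map_zero, add_zero, add_zero, smul_zero, map_smul, ← smul_add,
      ← h.resolvent_eq] at h2
    have h3 := congrArg Prod.snd (LinearPMap.mem_graph_snd_inj _ h1 h2 rfl)
    simp only at h3
    rw [h3, map_smul, smul_smul, smul_smul, sqrt_two_re_mul_self,
      mul_inv_cancel₀ (add_conj_ne_zero α α), one_smul]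
  · intro β hβ T hT u
    rw [extrapolatedResolventB_eq hD hα hRα hG hβ hT]
    obtain ⟨v, hv1, hv2⟩ := (LinearPMap.mem_graph_iff _).mp (hG' u)
    obtain ⟨v, hv⟩ := v
    obtain rfl : v = (G u, u) := hv1
    exact ⟨hv, (congrArg Prod.snd hv2).symm⟩

end halfplane

end DBR

theorem proposition6p2 {U Y : Type*}
    [NormedAddCommGroup U] [InnerProductSpace ℂ U] [CompleteSpace U]
    [TopologicalSpace.SeparableSpace U]
    [NormedAddCommGroup Y] [InnerProductSpace ℂ Y] [CompleteSpace Y]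
    [TopologicalSpace.SeparableSpace Y]
    (φ : DBR.Schur DBR.rightHalfPlane U Y) (α : DBR.rightHalfPlane) :
    ∃ (cA : DBR.HalfPlaneSpace φ →L[ℂ] DBR.HalfPlaneSpace φ)
      (cB : U →L[ℂ] DBR.HalfPlaneSpace φ)
      (cC : DBR.HalfPlaneSpace φ →L[ℂ] Y)
      (cD : U →L[ℂ] Y)
      (Ξ : DBR.DiskSpace (φ.onDisk α) ≃ₗᵢ[ℂ] DBR.HalfPlaneSpace φ)
      (A : DBR.DiskSpace (φ.onDisk α) →L[ℂ] DBR.DiskSpace (φ.onDisk α))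
      (B : U →L[ℂ] DBR.DiskSpace (φ.onDisk α))
      (C : DBR.DiskSpace (φ.onDisk α) →L[ℂ] Y)
      (D : U →L[ℂ] Y),
      -- the explicit operators, and their being the Cayley transform of the observable model
      DBR.IsExplicitCayley φ α cA cB cC cD ∧
      DBR.IsInternalCayleyTransform (DBR.obsNode φ) α cA cB cC cD ∧
      -- the unitary map and its inverse
      (∀ (ξ : DBR.DiskSpace (φ.onDisk α)) (μ : DBR.rightHalfPlane),
        Ξ ξ μ = ((√(2 * (α : ℂ).re) : ℂ) / ((starRingEnd ℂ) (α : ℂ) + μ)) •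
          ξ (DBR.toDisk α μ)) ∧
      (∀ (ζ : DBR.HalfPlaneSpace φ) (z : DBR.unitDisk),
        Ξ.symm ζ z = ((√(2 * (α : ℂ).re) : ℂ) / (1 + (z : ℂ))) • ζ (DBR.toHalfPlane α z)) ∧
      -- the classical disk model and the intertwinement
      DBR.IsDiskModel (φ.onDisk α) A B C D ∧
      (∀ ξ : DBR.DiskSpace (φ.onDisk α), cA (Ξ ξ) = Ξ (A ξ)) ∧
      (∀ u : U, cB u = Ξ (B u)) ∧
      (∀ ξ : DBR.DiskSpace (φ.onDisk α), cC (Ξ ξ) = C ξ) ∧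
      (∀ u : U, cD u = D u) := by
  obtain ⟨Ξ, hΞ⟩ := DBR.exists_diskSpace_equiv φ α
  obtain ⟨A, B, C, D, h⟩ := DBR.exists_isDiskColligation (φ.onDisk α)
  have hc := h.isHalfPlaneColligation hΞ
  exact ⟨_, _, _, _, Ξ, A, B, C, D, hc.isExplicitCayley, hc.isInternalCayleyTransform, hΞ,
    DBR.diskSpace_equiv_symm_apply hΞ, h.isDiskModel, fun ξ => by simp, fun u => rfl,
    fun ξ => by simp, fun u => rfl⟩
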